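/- Let $p_1,p_2\ge 0$ be coprime integers and let $h\in\mathbb{C}[x,y]$ be quasi-homogeneous of weight $(p_1,p_2)$ and degree $\delta$, i.e. every monomial $x^ky^l$ occurring in $h$ satisfies $p_1k+p_2l=\delta$. Suppose that $h$ has an isolated singularity at the origin: $h_x(0)=h_y(0)=0$, and $h_x,h_y$ have no other common zero in some neighbourhood of $0\in\mathbb{C}^2$ (it follows that $h(0)=0$). Let $\mathcal{O}_2=\mathbb{C}\{x,y\}$ be the ring of germs of holomorphic functions at $0\in\mathbb{C}^2$, let $\widehat{\mathcal{O}}_2=\mathbb{C}[[x,y]]$, and let $$X_0=\delta^{-1}\left(h_y\,\partial_x-h_x\,\partial_y\right),$$ acting as a derivation on $\mathcal{O}_2$ and on $\widehat{\mathcal{O}}_2$. Let $J_0=(h_x,h_y)\subset\mathcal{O}_2$ and $\widehat J_0=(h_x,h_y)\subset\widehat{\mathcal{O}}_2$ be the Jacobian ideals, i.e. the ideals generated by the components of $X_0$. Write $\mathbb{C}\{h\}$ (resp. $\mathbb{C}[[h]]$) for the ring of all $l(h)$ with $l$ a convergent (resp. formal) power series in one variable. Then $\mu=\dim_{\mathbb{C}}\mathcal{O}_2/J_0$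 is finite and positive, and the following hold. 1. The kernel of $X_0:\mathcal{O}_2\to\mathcal{O}_2$ is $\mathbb{C}\{h\}$. The vector space $\mathcal{O}_2/J_0$ has a basis consisting of the classes of monomials $a_1=1,a_2,\dots,a_\mu$. Whenever the classes of $a_1,\dots,a_\mu\in\mathcal{O}_2$ form a $\mathbb{C}$-basis of $\mathcal{O}_2/J_0$ (in particular for such monomials), their classes form a basis of the $\mathbb{C}\{h\}$-module $\mathcal{O}_2/\mathrm{Im}(X_0)$, which is therefore free of rank $\mu$. 2. The kernel of $X_0:\widehat{\mathcal{O}}_2\to\widehat{\mathcal{O}}_2$ is $\mathbb{C}[[h]]$. The vector space $\widehat{\mathcal{O}}_2/\widehat J_0$ has a basis consisting of the classes of monomials $a_1=1,a_2,\dots,a_\mu$, with the same number $\mu$. Whenever the classes of $a_1,\dots,a_\mu\in\widehat{\mathcal{O}}_2$ form a $\mathbb{C}$-basis of $\widehat{\mathcal{O}}_2/\widehat J_0$, their classes form a basis of the $\mathbb{C}[[h]]$-module $\widehat{\mathcal{O}}_2/\mathrm{Im}(X_0)$, which is therefore free of rank $\mu$. -/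

import Mathlib

noncomputable section

namespace HamiltonianCokernel

open Filter Topology

/-- A formal power series is convergent if it converges absolutely on some polydisc of positive
radius centred at the origin. -/
def IsConvergent {σ : Type*} (f : MvPowerSeries σ ℂ) : Prop :=
  ∃ r : ℝ, 0 < r ∧
    Summable fun m : σ →₀ ℕ => ‖MvPowerSeries.coeff m f‖ * r ^ m.degree

namespace IsConvergent

variable {σ : Type*}

theorem summable_of_le {f : MvPowerSeries σ ℂ} {r s : ℝ} (hs : 0 ≤ s) (hsr : s ≤ r)
    (hf : Summable fun m : σ →₀ ℕ => ‖MvPowerSeries.coeff m f‖ * r ^ m.degree) :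
    Summable fun m : σ →₀ ℕ => ‖MvPowerSeries.coeff m f‖ * s ^ m.degree :=
  Summable.of_nonneg_of_le (fun m => by positivity) (fun m => by gcongr) hf

theorem add {f g : MvPowerSeries σ ℂ} (hf : IsConvergent f) (hg : IsConvergent g) :
    IsConvergent (f + g) := by
  obtain ⟨r, hr, hf⟩ := hf
  obtain ⟨s, hs, hg⟩ := hg
  have ht : 0 < min r s := lt_min hr hs
  refine ⟨min r s, ht, ?_⟩
  refine Summable.of_nonneg_of_le (fun m => by positivity) (fun m => ?_)
    ((summable_of_le ht.le (min_le_left r s) hf).add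
      (summable_of_le ht.le (min_le_right r s) hg))
  rw [map_add, ← add_mul]
  gcongr
  exact norm_add_le _ _

theorem mul {f g : MvPowerSeries σ ℂ} (hf : IsConvergent f) (hg : IsConvergent g) :
    IsConvergent (f * g) := by
  classical
  obtain ⟨r, hr, hf⟩ := hf
  obtain ⟨s, hs, hg⟩ := hg
  obtain ⟨t, ht, htr, hts⟩ : ∃ t : ℝ, 0 < t ∧ t ≤ r ∧ t ≤ s :=
    ⟨min r s, lt_min hr hs, min_le_left r s, min_le_right r s⟩
  refine ⟨t, ht, ?_⟩
  have hF := summable_of_le ht.le htr hf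
  have hG := summable_of_le ht.le hts hg
  have hFG := hF.mul_of_nonneg hG (fun m => mul_nonneg (norm_nonneg _) (pow_nonneg ht.le _))
    (fun m => mul_nonneg (norm_nonneg _) (pow_nonneg ht.le _))
  have hsum := summable_sum_mul_antidiagonal_of_summable_mul
      (f := fun m : σ →₀ ℕ => ‖MvPowerSeries.coeff m f‖ * t ^ m.degree)
      (g := fun m : σ →₀ ℕ => ‖MvPowerSeries.coeff m g‖ * t ^ m.degree) hFG
  refine Summable.of_nonneg_of_le
    (fun m => mul_nonneg (norm_nonneg _) (pow_nonneg ht.le _)) (fun m => ?_) hsum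
  rw [MvPowerSeries.coeff_mul]
  refine (mul_le_mul_of_nonneg_right (norm_sum_le _ _) (pow_nonneg ht.le _)).trans ?_
  rw [Finset.sum_mul]
  refine Finset.sum_le_sum fun x hx => ?_
  have hm : x.1 + x.2 = m := Finset.HasAntidiagonal.mem_antidiagonal.mp hx
  have hd : m.degree = x.1.degree + x.2.degree := by rw [← hm, map_add]
  rw [hd, pow_add, norm_mul]
  exact le_of_eq (mul_mul_mul_comm _ _ _ _)

theorem coe (q : MvPolynomial σ ℂ) : IsConvergent (q : MvPowerSeries σ ℂ) := by
  refine ⟨1, one_pos, summable_of_ne_finset_zero (s := q.support) fun m hm => ?_⟩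
  rw [MvPolynomial.coeff_coe, MvPolynomial.notMem_support_iff.mp hm]
  simp

theorem pderiv (i : σ) {f : MvPowerSeries σ ℂ} (hf : IsConvergent f) :
    IsConvergent (MvPowerSeries.pderiv ℂ i f) := by
  obtain ⟨r, hr, hf⟩ := hf
  refine ⟨r / 2, by positivity, ?_⟩
  have hinj : Function.Injective fun m : σ →₀ ℕ => m + Finsupp.single i 1 :=
    add_left_injective _
  refine Summable.of_nonneg_of_le (fun m => by positivity) (fun m => ?_)
    ((hf.comp_injective hinj).mul_left (r⁻¹))
  rw [MvPowerSeries.coeff_pderiv]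
  have h1 : (m i : ℝ) + 1 ≤ 2 ^ m.degree := by
    have hle : m i ≤ m.degree := Finsupp.le_degree i m
    have hlt : m.degree < 2 ^ m.degree := Nat.lt_two_pow_self
    have : m i + 1 ≤ 2 ^ m.degree := by omega
    exact_mod_cast this
  have h2 : ‖(m i : ℂ) + 1‖ = (m i : ℝ) + 1 := by
    have : ((m i : ℂ) + 1) = ((m i + 1 : ℕ) : ℂ) := by push_cast; ring
    rw [this, Complex.norm_natCast]
    push_cast
    ring
  simp only [Function.comp_apply, map_add, Finsupp.degree_single, pow_add, pow_one, norm_mul, h2,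
    div_pow]
  have h3 : ((m i : ℝ) + 1) * (r ^ m.degree / 2 ^ m.degree) ≤ r ^ m.degree := by
    rw [mul_div_assoc', div_le_iff₀ (by positivity), mul_comm]
    gcongr
  calc ‖MvPowerSeries.coeff (m + Finsupp.single i 1) f‖ * ((m i : ℝ) + 1)
          * (r ^ m.degree / 2 ^ m.degree)
      = ‖MvPowerSeries.coeff (m + Finsupp.single i 1) f‖
          * (((m i : ℝ) + 1) * (r ^ m.degree / 2 ^ m.degree)) := by ring
    _ ≤ ‖MvPowerSeries.coeff (m + Finsupp.single i 1) f‖ * r ^ m.degree := by gcongr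
    _ = r⁻¹ * (‖MvPowerSeries.coeff (m + Finsupp.single i 1) f‖ * (r ^ m.degree * r)) := by
        field_simp

end IsConvergent

/-- The algebra of convergent power series in the variables `σ`. -/
def convergentSeries (σ : Type*) : Subalgebra ℂ (MvPowerSeries σ ℂ) where
  carrier := {f | IsConvergent f}
  mul_mem' := IsConvergent.mul
  add_mem' := IsConvergent.add
  algebraMap_mem' c := by
    have := IsConvergent.coe (σ := σ) (MvPolynomial.C c)
    rwa [MvPolynomial.coe_C] at this

/-- The ring of formal power series in two variables `x = X 0`, `y = X 1`. -/
abbrev FormalO2 : Type := MvPowerSeries (Fin 2) ℂ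

/-- The ring `ℂ{x, y}` of germs of holomorphic functions at the origin of `ℂ²`, realised as
the ring of convergent power series. -/
def O2 : Type := convergentSeries (Fin 2)

instance : CommRing O2 := inferInstanceAs (CommRing (convergentSeries (Fin 2)))

instance : Algebra ℂ O2 := inferInstanceAs (Algebra ℂ (convergentSeries (Fin 2)))

/-- The inclusion of the ring of germs in the ring of formal power series (Taylor expansion). -/
def taylor : O2 →ₐ[ℂ] FormalO2 := (convergentSeries (Fin 2)).val

theorem taylor_injective : Function.Injective taylor := Subtype.val_injective

theorem isConvergent_taylor (f : O2) : IsConvergent (taylor f) := f.2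

/-- A convergent power series seen as a germ. -/
def germ (f : FormalO2) (hf : IsConvergent f) : O2 := ⟨f, hf⟩

@[simp] theorem taylor_germ (f : FormalO2) (hf : IsConvergent f) : taylor (germ f hf) = f := rfl

/-- A polynomial seen as a germ. -/
def polyGerm (q : MvPolynomial (Fin 2) ℂ) : O2 := germ q (IsConvergent.coe q)

/-- The origin is a critical point of `h`, and it is isolated among the critical points of `h`. -/
def IsIsolatedSingularity (h : MvPolynomial (Fin 2) ℂ) : Prop :=
  (∀ i, MvPolynomial.eval (0 : Fin 2 → ℂ) (MvPolynomial.pderiv i h) = 0) ∧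
    ∀ᶠ z in 𝓝[≠] (0 : Fin 2 → ℂ), ∃ i, MvPolynomial.eval z (MvPolynomial.pderiv i h) ≠ 0

/-- The Hamiltonian derivation `δ⁻¹ (h_y ∂_x - h_x ∂_y)` of formal power series. -/
def formalX0 (δ : ℕ) (h : MvPolynomial (Fin 2) ℂ) : Derivation ℂ FormalO2 FormalO2 :=
  (δ : ℂ)⁻¹ •
    ((MvPolynomial.pderiv 1 h : FormalO2) • MvPowerSeries.pderiv ℂ (0 : Fin 2) -
      (MvPolynomial.pderiv 0 h : FormalO2) • MvPowerSeries.pderiv ℂ (1 : Fin 2))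

theorem formalX0_apply (δ : ℕ) (h : MvPolynomial (Fin 2) ℂ) (f : FormalO2) :
    formalX0 δ h f = (δ : ℂ)⁻¹ •
      ((MvPolynomial.pderiv 1 h : FormalO2) * MvPowerSeries.pderiv ℂ (0 : Fin 2) f -
        (MvPolynomial.pderiv 0 h : FormalO2) * MvPowerSeries.pderiv ℂ (1 : Fin 2) f) := rfl

theorem isConvergent_formalX0 (δ : ℕ) (h : MvPolynomial (Fin 2) ℂ) {f : FormalO2}
    (hf : IsConvergent f) : IsConvergent (formalX0 δ h f) := by
  rw [formalX0_apply]
  exact (convergentSeries (Fin 2)).smul_mem ((convergentSeries (Fin 2)).sub_mem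
    ((IsConvergent.coe _).mul (hf.pderiv 0)) ((IsConvergent.coe _).mul (hf.pderiv 1))) _

/-- The Hamiltonian derivation `δ⁻¹ (h_y ∂_x - h_x ∂_y)` of the ring of germs. -/
def X0 (δ : ℕ) (h : MvPolynomial (Fin 2) ℂ) : Derivation ℂ O2 O2 :=
  Derivation.mk'
    { toFun := fun f => germ (formalX0 δ h (taylor f))
        (isConvergent_formalX0 δ h (isConvergent_taylor f))
      map_add' := fun f g => taylor_injective (by simp)
      map_smul' := fun c f => taylor_injective (by simp) }
    (fun f g => taylor_injective (by simp))

@[simp] theorem taylor_X0 (δ : ℕ) (h : MvPolynomial (Fin 2) ℂ) (f : O2) :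
    taylor (X0 δ h f) = formalX0 δ h (taylor f) := rfl

theorem formalX0_self (δ : ℕ) (h : MvPolynomial (Fin 2) ℂ) :
    formalX0 δ h (h : FormalO2) = 0 := by
  rw [formalX0_apply, MvPowerSeries.pderiv_coe, MvPowerSeries.pderiv_coe]
  rw [mul_comm, sub_self, smul_zero]

/-- The Jacobian ideal of `h` in the ring of formal power series; up to the nonzero factor
`δ⁻¹`, its generators are the components of the Hamiltonian derivation. -/
def formalJ0 (h : MvPolynomial (Fin 2) ℂ) : Ideal FormalO2 :=
  Ideal.span {(MvPolynomial.pderiv 0 h : FormalO2), (MvPolynomial.pderiv 1 h : FormalO2)}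

/-- The Jacobian ideal of `h` in the ring of germs. -/
def J0 (h : MvPolynomial (Fin 2) ℂ) : Ideal O2 :=
  Ideal.span {polyGerm (MvPolynomial.pderiv 0 h), polyGerm (MvPolynomial.pderiv 1 h)}

/-- The Milnor number of `h`. -/
def milnor (h : MvPolynomial (Fin 2) ℂ) : ℕ := Module.finrank ℂ (O2 ⧸ J0 h)

/-- A polynomial without constant term can be substituted in any power series. -/
theorem hasSubst_coe {h : MvPolynomial (Fin 2) ℂ} (h0 : MvPolynomial.constantCoeff h = 0) :
    PowerSeries.HasSubst (h : FormalO2) := by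
  apply PowerSeries.HasSubst.of_constantCoeff_zero
  rw [← MvPowerSeries.coeff_zero_eq_constantCoeff_apply, MvPolynomial.coeff_coe]
  exact h0

/-- The algebra `ℂ[[h]]` of all `l(h)`, with `l` a formal power series in one variable. -/
def formalSeriesIn (h : MvPolynomial (Fin 2) ℂ) (h0 : MvPolynomial.constantCoeff h = 0) :
    Subalgebra ℂ FormalO2 :=
  (PowerSeries.substAlgHom (R := ℂ) (hasSubst_coe h0)).range

/-- The algebra `ℂ{h}` of all `l(h)`, with `l` a convergent power series in one variable. -/
def seriesIn (h : MvPolynomial (Fin 2) ℂ) (h0 : MvPolynomial.constantCoeff h = 0) :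
    Subalgebra ℂ O2 :=
  ((convergentSeries Unit).map (PowerSeries.substAlgHom (R := ℂ) (hasSubst_coe h0))).comap
    taylor

theorem mem_formalSeriesIn {h : MvPolynomial (Fin 2) ℂ}
    {h0 : MvPolynomial.constantCoeff h = 0} {f : FormalO2} :
    f ∈ formalSeriesIn h h0 ↔ ∃ l : PowerSeries ℂ, l.subst (h : FormalO2) = f := by
  simp only [formalSeriesIn, AlgHom.mem_range, PowerSeries.coe_substAlgHom]

theorem mem_seriesIn {h : MvPolynomial (Fin 2) ℂ}
    {h0 : MvPolynomial.constantCoeff h = 0} {f : O2} :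
    f ∈ seriesIn h h0 ↔
      ∃ l : PowerSeries ℂ, IsConvergent l ∧ l.subst (h : FormalO2) = taylor f := by
  simp only [seriesIn, Subalgebra.mem_comap, Subalgebra.mem_map, PowerSeries.coe_substAlgHom]
  rfl

/-- A derivation that kills `h` kills every power series in `h`. -/
theorem derivation_subst_eq_zero (D : Derivation ℂ FormalO2 FormalO2)
    {h : MvPolynomial (Fin 2) ℂ} (h0 : MvPolynomial.constantCoeff h = 0)
    (hD : D (h : FormalO2) = 0) (l : PowerSeries ℂ) : D (l.subst (h : FormalO2)) = 0 := by
  have hs := hasSubst_coe h0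
  have hc : MvPowerSeries.constantCoeff (h : FormalO2) = 0 := by
    rw [← MvPowerSeries.coeff_zero_eq_constantCoeff_apply, MvPolynomial.coeff_coe]
    exact h0
  ext d
  obtain ⟨n, hn⟩ : ∃ n : ℕ, d.degree < n := ⟨d.degree + 1, Nat.lt_succ_self _⟩
  obtain ⟨k, hk⟩ : (PowerSeries.X : PowerSeries ℂ) ^ n ∣ l - (PowerSeries.trunc n l : PowerSeries ℂ) := by
    rw [PowerSeries.X_pow_dvd_iff]
    intro m hm
    rw [map_sub, Polynomial.coeff_coe, PowerSeries.coeff_trunc, if_pos hm, sub_self]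
  have hl : l = (PowerSeries.trunc n l : PowerSeries ℂ) + PowerSeries.X ^ n * k := by
    rw [← hk]; ring
  have hpow : D ((h : FormalO2) ^ n) = 0 := by rw [Derivation.leibniz_pow, hD]; simp
  rw [hl, PowerSeries.subst_add hs, PowerSeries.subst_mul hs, PowerSeries.subst_pow hs,
    PowerSeries.subst_X hs, PowerSeries.subst_coe hs, map_add, Derivation.leibniz, hpow,
    smul_zero, add_zero, smul_eq_mul, D.map_aeval, hD, smul_zero, zero_add]
  rw [map_zero]
  apply MvPowerSeries.coeff_of_lt_order
  refine lt_of_lt_of_le ?_ MvPowerSeries.le_order_mul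
  refine lt_of_lt_of_le ?_ (le_add_right (MvPowerSeries.le_order_pow_of_constantCoeff_eq_zero n hc))
  exact_mod_cast hn

/-- A derivation that vanishes on a subalgebra `S`, as an `S`-linear map. -/
def linearOver {B : Type*} [CommRing B] [Algebra ℂ B] (D : Derivation ℂ B B)
    (S : Subalgebra ℂ B) (hS : ∀ s ∈ S, D s = 0) : B →ₗ[S] B where
  toFun := D
  map_add' := D.map_add
  map_smul' s f := by
    have h1 : D ((s : B) * f) = (s : B) * D f := by
      rw [D.leibniz, hS s s.2, smul_zero, add_zero, smul_eq_mul]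
    exact h1

theorem formalX0_formalSeriesIn (δ : ℕ) (h : MvPolynomial (Fin 2) ℂ)
    (h0 : MvPolynomial.constantCoeff h = 0) :
    ∀ s ∈ formalSeriesIn h h0, formalX0 δ h s = 0 := by
  intro s hs
  obtain ⟨l, rfl⟩ := mem_formalSeriesIn.mp hs
  exact derivation_subst_eq_zero _ h0 (formalX0_self δ h) l

theorem X0_seriesIn (δ : ℕ) (h : MvPolynomial (Fin 2) ℂ)
    (h0 : MvPolynomial.constantCoeff h = 0) :
    ∀ s ∈ seriesIn h h0, X0 δ h s = 0 := by
  intro s hs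
  obtain ⟨l, -, hl⟩ := mem_seriesIn.mp hs
  apply taylor_injective
  rw [taylor_X0, ← hl, map_zero]
  exact derivation_subst_eq_zero _ h0 (formalX0_self δ h) l

/-- The image of the Hamiltonian derivation of the ring of formal power series, as a
`ℂ[[h]]`-submodule. -/
def formalIm (δ : ℕ) (h : MvPolynomial (Fin 2) ℂ) (h0 : MvPolynomial.constantCoeff h = 0) :
    Submodule (formalSeriesIn h h0) FormalO2 :=
  LinearMap.range (linearOver (formalX0 δ h) _ (formalX0_formalSeriesIn δ h h0))

/-- The image of the Hamiltonian derivation of the ring of germs, as a `ℂ{h}`-submodule. -/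
def im (δ : ℕ) (h : MvPolynomial (Fin 2) ℂ) (h0 : MvPolynomial.constantCoeff h = 0) :
    Submodule (seriesIn h h0) O2 :=
  LinearMap.range (linearOver (X0 δ h) _ (X0_seriesIn δ h h0))

/-- The cokernel of the Hamiltonian derivation of the ring of formal power series, a
`ℂ[[h]]`-module. -/
abbrev FormalCoker (δ : ℕ) (h : MvPolynomial (Fin 2) ℂ)
    (h0 : MvPolynomial.constantCoeff h = 0) : Type := FormalO2 ⧸ formalIm δ h h0

/-- The cokernel of the Hamiltonian derivation of the ring of germs, a `ℂ{h}`-module. -/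
abbrev Coker (δ : ℕ) (h : MvPolynomial (Fin 2) ℂ)
    (h0 : MvPolynomial.constantCoeff h = 0) : Type := O2 ⧸ im δ h h0

/-- The family `v` is a basis of the `R`-module `M`. -/
def FormsBasis (R : Type*) {M ι : Type*} [Ring R] [AddCommGroup M] [Module R M] (v : ι → M) : Prop :=
  LinearIndependent R v ∧ Submodule.span R (Set.range v) = ⊤

/-- A quasi-homogeneous polynomial with an isolated singularity at the origin vanishes there. -/
theorem constantCoeff_eq_zero {p : Fin 2 → ℕ} (hp : Nat.Coprime (p 0) (p 1)) {δ : ℕ}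
    {h : MvPolynomial (Fin 2) ℂ} (hh : MvPolynomial.IsWeightedHomogeneous p h δ)
    (hs : IsIsolatedSingularity h) : MvPolynomial.constantCoeff h = 0 := by
  classical
  by_contra hne
  have hδ : δ = 0 := by
    have := hh (d := 0) hne
    simpa using this.symm
  subst hδ
  obtain ⟨i, hi⟩ : ∃ i, p i ≠ 0 := by
    by_contra! hz
    rw [hz 0, hz 1] at hp
    norm_num at hp
  -- no monomial of `h` involves the `i`-th variable
  have hsupp : ∀ m ∈ h.support, m i = 0 := by
    intro m hm
    have h1 := hh (MvPolynomial.mem_support_iff.mp hm)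
    rw [Finsupp.weight_apply, Finsupp.sum_fintype _ _ (by simp)] at h1
    have h2 := (Finset.sum_eq_zero_iff_of_nonneg (fun j _ => Nat.zero_le _)).mp h1 i
      (Finset.mem_univ i)
    simpa [hi] using h2
  -- hence the partial derivatives are constant along the corresponding axis
  have hcrit : ∀ t : ℂ, ∀ j, MvPolynomial.eval (Pi.single i t : Fin 2 → ℂ)
      (MvPolynomial.pderiv j h) = 0 := by
    intro t j
    rw [← hs.1 j]
    apply MvPolynomial.eval₂_congr
    intro k m hk hm
    have hmi : m i = 0 := by
      rw [MvPolynomial.coeff_pderiv] at hm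
      have := hsupp (m + Finsupp.single j 1) (MvPolynomial.mem_support_iff.mpr
        (left_ne_zero_of_mul hm))
      simp only [Finsupp.add_apply] at this
      omega
    have hki : k ≠ i := by
      rintro rfl
      exact (Finsupp.mem_support_iff.mp hk) hmi
    simp [hki]
  have hlim : Tendsto (fun t : ℂ => (Pi.single i t : Fin 2 → ℂ)) (𝓝[≠] 0) (𝓝[≠] 0) := by
    refine tendsto_nhdsWithin_iff.mpr ⟨?_, ?_⟩
    · have hc : Continuous fun t : ℂ => (Pi.single i t : Fin 2 → ℂ) :=
        continuous_pi fun j => by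
          rcases eq_or_ne j i with rfl | hji
          · simpa using continuous_id'
          · simpa [hji] using continuous_const
      have := hc.tendsto 0
      rw [Pi.single_zero] at this
      exact this.mono_left nhdsWithin_le_nhds
    · filter_upwards [self_mem_nhdsWithin] with t ht
      simpa using ht
  obtain ⟨t, j, hj⟩ := (hlim.eventually hs.2).exists
  exact hj (hcrit t j)

end HamiltonianCokernel

end

/-! Put `H = h_y ∂_x - h_x ∂_y`, which is `δ X_0`, and let `E` be the Euler derivation of weight
`p`. It is diagonal on monomials, and `E h = δ h` with `δ ≠ 0`. Since `H h = 0`, multiplication by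
`h` commutes with `H`.

The kernel and the absence of `h`-torsion both come from one division statement,
`exists_eq_const_add_mul`: if `H w = h g`, then `w = c + h t` with `c` constant and `H t = g`.
Euler's identity and Cramer's rule show that `h_x E w` and `h_y E w` are multiples of `h`. The
Jacobian ideal `J` contains powers of both variables, so `E w` is itself a multiple `h s`
(`euler_dvd`). Solving `(E + δ) t = s` coefficientwise gives `E (w - h t) = 0`, and `w - h t` turns
out to be constant. With `g = 0`, iteration expands `w` as a power series in `h`. With general `g`,
it says that `h b ∈ Im H` implies `b ∈ Im H`.

For the cokernel, the decisive identity is `J = (h) + Im H`. It makes a basis of the quotient by `J`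
a basis of the cokernel modulo `h`. Torsion-freeness then gives independence over the series in `h`,
and Nakayama's lemma gives generation (`formsBasis_coker`). Nakayama needs finite generation
beforehand. It comes from a reduction `g = (finitely many monomials) + h S g + H (W g)`, iterated to
`g = ∑ h^k (...)`. In the convergent case `S` and `W` are bounded for the `ℓ¹` norms of small
polydiscs, and `h` is small there, so the iterated sums converge.

If both weights are positive, the weighted scaling action makes the origin the only critical point,
and the Nullstellensatz puts powers of the variables in `J`. If a weight vanishes, the weights are
`0` and `1`, and `h` is the product of the two variables and a unit in the weight-zero variable.
This node is treated by hand (`IsNode`). The formal and convergent local algebras agree because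
modulo `J` every series is a polynomial of bounded degree (`milnorEquiv`). -/

noncomputable section

namespace HamiltonianCokernel

open Filter Topology
open scoped ENNReal NNReal

/-! ### Weighted `ℓ¹` norms and sums of powers of a small series -/

section Norm

variable {σ : Type*}

/-- The weighted `ℓ¹`-norm of a power series, with values in `[0, ∞]`. -/
def wnorm (r : ℝ≥0) (f : MvPowerSeries σ ℂ) : ℝ≥0∞ :=
  ∑' m : σ →₀ ℕ, ‖MvPowerSeries.coeff m f‖ₑ * (r : ℝ≥0∞) ^ m.degree

theorem enorm_coeff_mul_le_wnorm (r : ℝ≥0) (f : MvPowerSeries σ ℂ) (m : σ →₀ ℕ) :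
    ‖MvPowerSeries.coeff m f‖ₑ * (r : ℝ≥0∞) ^ m.degree ≤ wnorm r f :=
  ENNReal.le_tsum (f := fun m : σ →₀ ℕ => ‖MvPowerSeries.coeff m f‖ₑ * (r : ℝ≥0∞) ^ m.degree) m

theorem isConvergent_iff_wnorm {f : MvPowerSeries σ ℂ} :
    IsConvergent f ↔ ∃ r : ℝ≥0, 0 < r ∧ wnorm r f ≠ ∞ := by
  have key : ∀ r : ℝ≥0, wnorm r f ≠ ∞ ↔
      Summable fun m : σ →₀ ℕ => ‖MvPowerSeries.coeff m f‖ * (r : ℝ) ^ m.degree := by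
    intro r
    have h1 : wnorm r f = ∑' m : σ →₀ ℕ,
        ((‖MvPowerSeries.coeff m f‖₊ * r ^ m.degree : ℝ≥0) : ℝ≥0∞) := by
      simp only [wnorm, ENNReal.coe_mul, ENNReal.coe_pow, enorm_eq_nnnorm]
    rw [h1, ENNReal.tsum_coe_ne_top_iff_summable, ← NNReal.summable_coe]
    simp
  constructor
  · rintro ⟨r, hr, h⟩
    exact ⟨⟨r, hr.le⟩, hr, (key _).2 h⟩
  · rintro ⟨r, hr, h⟩
    exact ⟨r, hr, (key r).1 h⟩

theorem wnorm_mono {r s : ℝ≥0} (h : r ≤ s) (f : MvPowerSeries σ ℂ) : wnorm r f ≤ wnorm s f := by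
  unfold wnorm; gcongr

theorem wnorm_add_le (r : ℝ≥0) (f g : MvPowerSeries σ ℂ) :
    wnorm r (f + g) ≤ wnorm r f + wnorm r g := by
  unfold wnorm
  rw [← ENNReal.tsum_add]
  refine ENNReal.tsum_le_tsum fun m => ?_
  rw [← add_mul, map_add]
  gcongr
  exact enorm_add_le _ _

theorem wnorm_smul (r : ℝ≥0) (c : ℂ) (f : MvPowerSeries σ ℂ) :
    wnorm r (c • f) = ‖c‖ₑ * wnorm r f := by
  unfold wnorm
  rw [← ENNReal.tsum_mul_left]
  simp [enorm_mul, mul_assoc]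

theorem wnorm_neg (r : ℝ≥0) (f : MvPowerSeries σ ℂ) : wnorm r (-f) = wnorm r f := by
  simp [wnorm]

theorem wnorm_sub_le (r : ℝ≥0) (f g : MvPowerSeries σ ℂ) :
    wnorm r (f - g) ≤ wnorm r f + wnorm r g := by
  rw [sub_eq_add_neg, ← wnorm_neg r g]; exact wnorm_add_le r f (-g)

theorem wnorm_monomial (r : ℝ≥0) (m : σ →₀ ℕ) (c : ℂ) :
    wnorm r (MvPowerSeries.monomial m c) = ‖c‖ₑ * (r : ℝ≥0∞) ^ m.degree := by
  classical
  unfold wnorm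
  rw [tsum_eq_single m]
  · simp
  · intro b hb
    rw [MvPowerSeries.coeff_monomial, if_neg hb]; simp

theorem wnorm_one (r : ℝ≥0) : wnorm r (1 : MvPowerSeries σ ℂ) = 1 := by
  rw [← MvPowerSeries.monomial_zero_one, wnorm_monomial]; simp

/-- The product of the two sums is regrouped along antidiagonals; with values in `[0, ∞]` this needs
no summability hypothesis. -/
theorem wnorm_mul_le (r : ℝ≥0) (f g : MvPowerSeries σ ℂ) :
    wnorm r (f * g) ≤ wnorm r f * wnorm r g := by
  classical
  have h1 : wnorm r f * wnorm r g = ∑' q : (σ →₀ ℕ) × (σ →₀ ℕ),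
      (‖MvPowerSeries.coeff q.1 f‖ₑ * (r : ℝ≥0∞) ^ q.1.degree) *
        (‖MvPowerSeries.coeff q.2 g‖ₑ * (r : ℝ≥0∞) ^ q.2.degree) := by
    rw [ENNReal.tsum_prod' (f := fun q : (σ →₀ ℕ) × (σ →₀ ℕ) =>
      (‖MvPowerSeries.coeff q.1 f‖ₑ * (r : ℝ≥0∞) ^ q.1.degree) *
        (‖MvPowerSeries.coeff q.2 g‖ₑ * (r : ℝ≥0∞) ^ q.2.degree))]
    simp only [ENNReal.tsum_mul_left, ENNReal.tsum_mul_right, wnorm]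
  rw [h1, ← Finset.HasAntidiagonal.sigmaAntidiagonalEquivProd.tsum_eq, ENNReal.tsum_sigma']
  refine ENNReal.tsum_le_tsum fun m => ?_
  rw [tsum_fintype, MvPowerSeries.coeff_mul]
  simp only [Finset.HasAntidiagonal.sigmaAntidiagonalEquivProd_apply]
  rw [Finset.sum_coe_sort (Finset.HasAntidiagonal.antidiagonal m) (fun q : (σ →₀ ℕ) × (σ →₀ ℕ) =>
      (‖MvPowerSeries.coeff q.1 f‖ₑ * (r : ℝ≥0∞) ^ q.1.degree) *
        (‖MvPowerSeries.coeff q.2 g‖ₑ * (r : ℝ≥0∞) ^ q.2.degree))]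
  refine (mul_le_mul_left (enorm_sum_le _ _) _).trans ?_
  rw [Finset.sum_mul]
  refine Finset.sum_le_sum fun x hx => ?_
  have hm : x.1 + x.2 = m := Finset.HasAntidiagonal.mem_antidiagonal.mp hx
  rw [← hm, map_add, pow_add, enorm_mul]
  exact le_of_eq (mul_mul_mul_comm _ _ _ _)

theorem wnorm_pow_le (r : ℝ≥0) (f : MvPowerSeries σ ℂ) (n : ℕ) :
    wnorm r (f ^ n) ≤ wnorm r f ^ n := by
  induction n with
  | zero => simp [wnorm_one]
  | succ n ih =>
    rw [pow_succ, pow_succ]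
    exact (wnorm_mul_le r _ _).trans (by gcongr)

theorem wnorm_le_of_injective {r : ℝ≥0} {f g : MvPowerSeries σ ℂ} {C : ℝ≥0∞}
    {φ : (σ →₀ ℕ) → σ →₀ ℕ} (hφ : Function.Injective φ)
    (h : ∀ m, ‖MvPowerSeries.coeff m g‖ₑ * (r : ℝ≥0∞) ^ m.degree ≤
      C * (‖MvPowerSeries.coeff (φ m) f‖ₑ * (r : ℝ≥0∞) ^ (φ m).degree)) :
    wnorm r g ≤ C * wnorm r f := by
  calc wnorm r g ≤ ∑' m, C * (‖MvPowerSeries.coeff (φ m) f‖ₑ * (r : ℝ≥0∞) ^ (φ m).degree) :=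
        ENNReal.tsum_le_tsum h
    _ = C * ∑' m, (‖MvPowerSeries.coeff (φ m) f‖ₑ * (r : ℝ≥0∞) ^ (φ m).degree) :=
        ENNReal.tsum_mul_left
    _ ≤ C * wnorm r f := by
        gcongr
        exact ENNReal.tsum_comp_le_tsum_of_injective hφ
          (fun m => ‖MvPowerSeries.coeff m f‖ₑ * (r : ℝ≥0∞) ^ m.degree)

/-- Norms on small polydiscs of a series without constant term are small. -/
theorem wnorm_mul_le_of_constantCoeff_eq_zero {r s : ℝ≥0} (hr : 0 < r) (hs : s ≤ r)
    {f : MvPowerSeries σ ℂ} (hf : MvPowerSeries.constantCoeff f = 0) :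
    wnorm s f ≤ ((s / r : ℝ≥0) : ℝ≥0∞) * wnorm r f := by
  unfold wnorm
  rw [← ENNReal.tsum_mul_left]
  refine ENNReal.tsum_le_tsum fun m => ?_
  rcases eq_or_ne m 0 with rfl | hm
  · simp [hf]
  · have hd : m.degree ≠ 0 := fun h => hm ((Finsupp.degree_eq_zero_iff m).1 h)
    obtain ⟨n, hn⟩ := Nat.exists_eq_succ_of_ne_zero hd
    have h2 : s ^ m.degree ≤ (s / r) * r ^ m.degree := by
      rw [hn, Nat.succ_eq_add_one, pow_succ, pow_succ]
      calc s ^ n * s ≤ r ^ n * s := by gcongr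
        _ = s / r * (r ^ n * r) := by field_simp
    calc _ ≤ ‖MvPowerSeries.coeff m f‖ₑ * (((s / r : ℝ≥0) : ℝ≥0∞) * (r : ℝ≥0∞) ^ m.degree) := by
          gcongr
          exact_mod_cast h2
      _ = _ := by ring

/-- The formal sum `∑ uᵏ vₖ`, for a series `u` without constant term. -/
def powSum (u : MvPowerSeries σ ℂ) (v : ℕ → MvPowerSeries σ ℂ) : MvPowerSeries σ ℂ :=
  fun m => ∑ k ∈ Finset.range (m.degree + 1), MvPowerSeries.coeff m (u ^ k * v k)

/-- `u ^ k` has order at least `k`, so the truncation in `powSum` discards only zero terms. -/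
theorem coeff_pow_mul_eq_zero {u : MvPowerSeries σ ℂ} (hu : MvPowerSeries.constantCoeff u = 0)
    (v : MvPowerSeries σ ℂ) {m : σ →₀ ℕ} {k : ℕ} (h : m.degree < k) :
    MvPowerSeries.coeff m (u ^ k * v) = 0 := by
  apply MvPowerSeries.coeff_of_lt_order
  refine lt_of_lt_of_le ?_ MvPowerSeries.le_order_mul
  refine lt_of_lt_of_le ?_
    (le_add_right (MvPowerSeries.le_order_pow_of_constantCoeff_eq_zero k hu))
  exact_mod_cast h

theorem coeff_powSum {u : MvPowerSeries σ ℂ} (hu : MvPowerSeries.constantCoeff u = 0)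
    (v : ℕ → MvPowerSeries σ ℂ) {m : σ →₀ ℕ} {n : ℕ} (h : m.degree < n) :
    MvPowerSeries.coeff m (powSum u v) =
      ∑ k ∈ Finset.range n, MvPowerSeries.coeff m (u ^ k * v k) := by
  change ∑ k ∈ Finset.range (m.degree + 1), MvPowerSeries.coeff m (u ^ k * v k) = _
  refine Finset.sum_subset (Finset.range_mono h) fun k _ hk => ?_
  exact coeff_pow_mul_eq_zero hu _ (by simpa using hk)

theorem powSum_eq {u : MvPowerSeries σ ℂ} (hu : MvPowerSeries.constantCoeff u = 0)
    (v : ℕ → MvPowerSeries σ ℂ) : powSum u v = v 0 + u * powSum u (fun k => v (k + 1)) := by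
  classical
  ext m
  rw [map_add, coeff_powSum hu v (n := m.degree + 1 + 1) (by omega), Finset.sum_range_succ',
    pow_zero, one_mul, add_comm]
  congr 1
  rw [MvPowerSeries.coeff_mul]
  have : ∀ x ∈ Finset.HasAntidiagonal.antidiagonal m, MvPowerSeries.coeff x.1 u *
      MvPowerSeries.coeff x.2 (powSum u fun k => v (k + 1)) =
      ∑ k ∈ Finset.range (m.degree + 1), MvPowerSeries.coeff x.1 u *
        MvPowerSeries.coeff x.2 (u ^ k * v (k + 1)) := by
    intro x hx
    have hm : x.1 + x.2 = m := Finset.HasAntidiagonal.mem_antidiagonal.mp hx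
    rw [coeff_powSum hu _ (n := m.degree + 1) (by rw [← hm, map_add]; omega), Finset.mul_sum]
  rw [Finset.sum_congr rfl this, Finset.sum_comm]
  refine Finset.sum_congr rfl fun k _ => ?_
  rw [← MvPowerSeries.coeff_mul, pow_succ']
  congr 1; ring

theorem powSum_eq_sum_add {u : MvPowerSeries σ ℂ} (hu : MvPowerSeries.constantCoeff u = 0)
    (v : ℕ → MvPowerSeries σ ℂ) (n : ℕ) :
    powSum u v = ∑ k ∈ Finset.range n, u ^ k * v k + u ^ n * powSum u (fun k => v (n + k)) := by
  induction n with
  | zero => simp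
  | succ n ih =>
    rw [Finset.sum_range_succ, ih, powSum_eq hu (fun k => v (n + k))]
    have : (fun k => v (n + (k + 1))) = fun k => v (n + 1 + k) := by
      funext k; congr 1; omega
    rw [this, add_zero]
    ring

theorem wnorm_powSum_le (r : ℝ≥0) {u : MvPowerSeries σ ℂ}
    (v : ℕ → MvPowerSeries σ ℂ) :
    wnorm r (powSum u v) ≤ ∑' k, wnorm r u ^ k * wnorm r (v k) := by
  calc wnorm r (powSum u v) ≤ ∑' m : σ →₀ ℕ, ∑' k,
        ‖MvPowerSeries.coeff m (u ^ k * v k)‖ₑ * (r : ℝ≥0∞) ^ m.degree := by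
        refine ENNReal.tsum_le_tsum fun m => ?_
        rw [ENNReal.tsum_mul_right]
        gcongr
        exact (enorm_sum_le (Finset.range (m.degree + 1))
          fun k => MvPowerSeries.coeff m (u ^ k * v k)).trans
          (ENNReal.sum_le_tsum _)
    _ = ∑' k, wnorm r (u ^ k * v k) := ENNReal.tsum_comm
    _ ≤ _ := ENNReal.tsum_le_tsum fun k => (wnorm_mul_le r _ _).trans (by
        gcongr; exact wnorm_pow_le r u k)

/-- As `u` vanishes at the origin, its norm tends to zero at least linearly with the radius. A small
enough polydisc therefore beats any geometric growth `C ^ k` of the terms. All convergence of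
iterated constructions rests on this. -/
theorem isConvergent_powSum {u : MvPowerSeries σ ℂ} (hu : MvPowerSeries.constantCoeff u = 0)
    (huc : IsConvergent u) {v : ℕ → MvPowerSeries σ ℂ} {r : ℝ≥0} (hr : 0 < r) {D : ℝ≥0∞}
    (hD : D ≠ ∞) (C : ℝ≥0) (hv : ∀ k, wnorm r (v k) ≤ D * (C : ℝ≥0∞) ^ k) :
    IsConvergent (powSum u v) := by
  obtain ⟨t, ht, hut⟩ := isConvergent_iff_wnorm.1 huc
  lift wnorm t u to ℝ≥0 using hut with U hU
  obtain ⟨s, hs, hst, hsr, hsU⟩ : ∃ s : ℝ≥0, 0 < s ∧ s ≤ t ∧ s ≤ r ∧ s / t * U * C ≤ 2⁻¹ := by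
    -- The `+ 1` keeps the denominator positive when `U * C = 0`.
    refine ⟨min (min t r) (t * 2⁻¹ / (U * C + 1)), ?_, ?_, ?_, ?_⟩
    · refine lt_min (lt_min ht hr) (by positivity)
    · exact (min_le_left _ _).trans (min_le_left _ _)
    · exact (min_le_left _ _).trans (min_le_right _ _)
    · calc _ ≤ (t * 2⁻¹ / (U * C + 1)) / t * U * C := by gcongr; exact min_le_right _ _
        _ = 2⁻¹ * ((U * C) / (U * C + 1)) := by field_simp
        _ ≤ 2⁻¹ * 1 := by
            gcongr
            exact div_le_one_of_le₀ (by simp) (by positivity)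
        _ = 2⁻¹ := mul_one _
  refine isConvergent_iff_wnorm.2 ⟨s, hs, ne_top_of_le_ne_top ?_ (wnorm_powSum_le s v)⟩
  have hk : ∀ k, wnorm s u ^ k * wnorm s (v k) ≤ D * (2⁻¹ : ℝ≥0∞) ^ k := by
    intro k
    have h1 : wnorm s u * C ≤ 2⁻¹ := by
      calc wnorm s u * C ≤ ((s / t : ℝ≥0) : ℝ≥0∞) * wnorm t u * C := by
            gcongr; exact wnorm_mul_le_of_constantCoeff_eq_zero ht hst hu
        _ = ((s / t * U * C : ℝ≥0) : ℝ≥0∞) := by rw [← hU]; push_cast; rfl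
        _ ≤ ((2⁻¹ : ℝ≥0) : ℝ≥0∞) := by exact_mod_cast hsU
        _ = 2⁻¹ := by rw [ENNReal.coe_inv (by norm_num)]; rfl
    calc wnorm s u ^ k * wnorm s (v k) ≤ wnorm s u ^ k * (D * (C : ℝ≥0∞) ^ k) := by
          gcongr; exact (wnorm_mono hsr _).trans (hv k)
      _ = D * (wnorm s u * C) ^ k := by rw [mul_pow]; ring
      _ ≤ _ := by gcongr
  refine ne_top_of_le_ne_top ?_ (ENNReal.tsum_le_tsum hk)
  rw [ENNReal.tsum_mul_left, ENNReal.tsum_geometric]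
  refine ENNReal.mul_ne_top hD ?_
  rw [ENNReal.inv_ne_top, ENNReal.one_sub_inv_two]
  simp

theorem IsConvergent.sub {f g : MvPowerSeries σ ℂ} (hf : IsConvergent f) (hg : IsConvergent g) :
    IsConvergent (f - g) := (convergentSeries σ).sub_mem hf hg

theorem IsConvergent.smul {f : MvPowerSeries σ ℂ} (c : ℂ) (hf : IsConvergent f) :
    IsConvergent (c • f) := (convergentSeries σ).smul_mem hf c

theorem IsConvergent.const (c : ℂ) : IsConvergent (MvPowerSeries.C c : MvPowerSeries σ ℂ) :=
  (convergentSeries σ).algebraMap_mem c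

theorem IsConvergent.one : IsConvergent (1 : MvPowerSeries σ ℂ) := (convergentSeries σ).one_mem

theorem IsConvergent.X (i : σ) : IsConvergent (MvPowerSeries.X i : MvPowerSeries σ ℂ) := by
  simpa using IsConvergent.coe (MvPolynomial.X i : MvPolynomial σ ℂ)

theorem IsConvergent.pow {f : MvPowerSeries σ ℂ} (hf : IsConvergent f) (n : ℕ) :
    IsConvergent (f ^ n) := (convergentSeries σ).pow_mem hf n

/-- Geometric series: `f = c (1 - u)` with `u` of zero constant term. -/
theorem IsConvergent.inv {f : MvPowerSeries σ ℂ} (hf : IsConvergent f)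
    (h0 : MvPowerSeries.constantCoeff f ≠ 0) : IsConvergent f⁻¹ := by
  set c := MvPowerSeries.constantCoeff f
  set u := 1 - c⁻¹ • f with hu_def
  have hu : MvPowerSeries.constantCoeff u = 0 := by
    rw [hu_def, map_sub, map_one, MvPowerSeries.smul_eq_C_mul, map_mul,
      MvPowerSeries.constantCoeff_C, inv_mul_cancel₀ h0, sub_self]
  have huc : IsConvergent u := IsConvergent.one.sub (hf.smul _)
  have hT := isConvergent_powSum hu huc (v := fun _ => 1) one_pos (D := 1) (by simp) 1
    (fun k => by simp [wnorm_one])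
  have hmul : f * (c⁻¹ • powSum u fun _ => 1) = 1 := by
    have h1 := powSum_eq hu (fun _ => 1)
    have h2 : (1 - u) * powSum u (fun _ => 1) = 1 := by
      linear_combination h1
    rw [hu_def, sub_sub_cancel] at h2
    rw [mul_smul_comm, ← smul_mul_assoc]
    exact h2
  have : f⁻¹ = c⁻¹ • powSum u fun _ => 1 := by
    rw [MvPowerSeries.inv_eq_iff_mul_eq_one h0, mul_comm]; exact hmul
  rw [this]
  exact hT.smul _

end Norm

/-! ### Shifts and diagonal operators on coefficients -/

section Operators

variable {σ : Type*}

/-- The series whose coefficients are those of `f`, moved `n` steps down in the direction `i`. -/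
def shift (i : σ) (n : ℕ) (f : MvPowerSeries σ ℂ) : MvPowerSeries σ ℂ :=
  fun m => MvPowerSeries.coeff (m + Finsupp.single i n) f

@[simp] theorem coeff_shift (i : σ) (n : ℕ) (f : MvPowerSeries σ ℂ) (m : σ →₀ ℕ) :
    MvPowerSeries.coeff m (shift i n f) = MvPowerSeries.coeff (m + Finsupp.single i n) f := rfl

/-- The series obtained from `f` by multiplying the coefficient of index `m` by `w m`. -/
def diag (w : (σ →₀ ℕ) → ℂ) (f : MvPowerSeries σ ℂ) : MvPowerSeries σ ℂ :=
  fun m => w m * MvPowerSeries.coeff m f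

@[simp] theorem coeff_diag (w : (σ →₀ ℕ) → ℂ) (f : MvPowerSeries σ ℂ) (m : σ →₀ ℕ) :
    MvPowerSeries.coeff m (diag w f) = w m * MvPowerSeries.coeff m f := rfl

open Classical in
/-- The part of `f` that does not involve the variable `i`. -/
def freeOf (i : σ) (f : MvPowerSeries σ ℂ) : MvPowerSeries σ ℂ :=
  diag (fun m => if m i = 0 then 1 else 0) f

open Classical in
theorem coeff_freeOf (i : σ) (f : MvPowerSeries σ ℂ) (m : σ →₀ ℕ) :
    MvPowerSeries.coeff m (freeOf i f) = if m i = 0 then MvPowerSeries.coeff m f else 0 := by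
  simp [freeOf]

theorem coeff_X_pow_mul_add (i : σ) (n : ℕ) (f : MvPowerSeries σ ℂ) (m : σ →₀ ℕ) :
    MvPowerSeries.coeff (m + Finsupp.single i n) (MvPowerSeries.X i ^ n * f) =
      MvPowerSeries.coeff m f := by
  rw [MvPowerSeries.X_pow_eq, add_comm, MvPowerSeries.coeff_add_monomial_mul, one_mul]

theorem coeff_X_pow_mul_of_lt (i : σ) {n : ℕ} (f : MvPowerSeries σ ℂ) {m : σ →₀ ℕ} (h : m i < n) :
    MvPowerSeries.coeff m (MvPowerSeries.X i ^ n * f) = 0 :=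
  MvPowerSeries.X_pow_dvd_iff.1 (dvd_mul_right _ _) m h

theorem exists_eq_add_single {i : σ} {n : ℕ} {m : σ →₀ ℕ} (h : n ≤ m i) :
    ∃ k, m = k + Finsupp.single i n :=
  ⟨m - Finsupp.single i n, (tsub_add_cancel_of_le (Finsupp.single_le_iff.2 h)).symm⟩

theorem X_pow_mul_shift {i : σ} {n : ℕ} {f : MvPowerSeries σ ℂ}
    (hf : ∀ m : σ →₀ ℕ, m i < n → MvPowerSeries.coeff m f = 0) :
    MvPowerSeries.X i ^ n * shift i n f = f := by
  ext m
  rcases lt_or_ge (m i) n with h | h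
  · rw [coeff_X_pow_mul_of_lt i _ h, hf m h]
  · obtain ⟨k, rfl⟩ := exists_eq_add_single h
    rw [coeff_X_pow_mul_add, coeff_shift]

theorem freeOf_add_X_mul_shift (i : σ) (f : MvPowerSeries σ ℂ) :
    freeOf i f + MvPowerSeries.X i * shift i 1 f = f := by
  classical
  ext m
  rw [map_add, coeff_freeOf, ← pow_one (MvPowerSeries.X i)]
  rcases Nat.eq_zero_or_pos (m i) with h | h
  · rw [if_pos h, coeff_X_pow_mul_of_lt i _ (by omega), add_zero]
  · obtain ⟨k, rfl⟩ := exists_eq_add_single (n := 1) h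
    rw [if_neg h.ne', zero_add, coeff_X_pow_mul_add, coeff_shift]

theorem wnorm_shift_le {r : ℝ≥0} (hr : 0 < r) (i : σ) (n : ℕ) (f : MvPowerSeries σ ℂ) :
    wnorm r (shift i n f) ≤ ((r ^ n : ℝ≥0) : ℝ≥0∞)⁻¹ * wnorm r f := by
  refine wnorm_le_of_injective (φ := fun m => m + Finsupp.single i n) (add_left_injective _)
    fun m => ?_
  have h0 : ((r ^ n : ℝ≥0) : ℝ≥0∞) ≠ 0 := by simpa using fun h => absurd h hr.ne'
  rw [coeff_shift, map_add, Finsupp.degree_single, pow_add, ← ENNReal.coe_pow r n]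
  apply le_of_eq
  calc _ = (((r ^ n : ℝ≥0) : ℝ≥0∞)⁻¹ * ((r ^ n : ℝ≥0) : ℝ≥0∞)) *
        (‖MvPowerSeries.coeff (m + Finsupp.single i n) f‖ₑ * (r : ℝ≥0∞) ^ m.degree) := by
        rw [ENNReal.inv_mul_cancel h0 ENNReal.coe_ne_top, one_mul]
    _ = _ := by ring

theorem wnorm_diag_le (r : ℝ≥0) {w : (σ →₀ ℕ) → ℂ} {C : ℝ≥0} (hw : ∀ m, ‖w m‖₊ ≤ C)
    (f : MvPowerSeries σ ℂ) : wnorm r (diag w f) ≤ C * wnorm r f := by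
  refine wnorm_le_of_injective Function.injective_id fun m => ?_
  rw [coeff_diag, enorm_mul, mul_assoc, id]
  gcongr
  rw [enorm_eq_nnnorm]
  exact_mod_cast hw m

theorem wnorm_freeOf_le (r : ℝ≥0) (i : σ) (f : MvPowerSeries σ ℂ) :
    wnorm r (freeOf i f) ≤ wnorm r f := by
  have := wnorm_diag_le r (w := fun m : σ →₀ ℕ => if m i = 0 then 1 else 0) (C := 1)
    (fun m => by split_ifs <;> simp) f
  simpa [freeOf] using this

theorem IsConvergent.of_wnorm_le {f g : MvPowerSeries σ ℂ} (hf : IsConvergent f)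
    (h : ∀ r : ℝ≥0, 0 < r → ∃ C : ℝ≥0∞, C ≠ ∞ ∧ wnorm r g ≤ C * wnorm r f) : IsConvergent g := by
  obtain ⟨r, hr, hf⟩ := isConvergent_iff_wnorm.1 hf
  obtain ⟨C, hC, hle⟩ := h r hr
  exact isConvergent_iff_wnorm.2 ⟨r, hr, ne_top_of_le_ne_top (ENNReal.mul_ne_top hC hf) hle⟩

theorem IsConvergent.shift {f : MvPowerSeries σ ℂ} (hf : IsConvergent f) (i : σ) (n : ℕ) :
    IsConvergent (shift i n f) :=
  hf.of_wnorm_le fun r hr => ⟨_, by simpa using fun h => absurd h hr.ne', wnorm_shift_le hr i n f⟩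

theorem IsConvergent.diag {f : MvPowerSeries σ ℂ} (hf : IsConvergent f) {w : (σ →₀ ℕ) → ℂ}
    {C : ℝ≥0} (hw : ∀ m, ‖w m‖₊ ≤ C) : IsConvergent (diag w f) :=
  hf.of_wnorm_le fun r _ => ⟨C, by simp, wnorm_diag_le r hw f⟩

/-- Coprimality of powers of distinct variables: multiplying by `X j ^ n` does not change exponents
of `X i`, so `f` has no coefficient with exponent below `n` in `X i`. -/
theorem X_pow_dvd_of_mul_eq {i j : σ} (hij : i ≠ j) {n : ℕ} {f g : MvPowerSeries σ ℂ}
    (h : MvPowerSeries.X j ^ n * f = MvPowerSeries.X i ^ n * g) :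
    MvPowerSeries.X i ^ n * HamiltonianCokernel.shift i n f = f := by
  classical
  refine X_pow_mul_shift fun m hm => ?_
  rw [← coeff_X_pow_mul_add j n f m, h]
  exact coeff_X_pow_mul_of_lt i g (by simpa [hij.symm] using hm)

end Operators

/-! ### Power series in one variable and their substitution -/

section OneVariable

theorem wnorm_powerSeries (r : ℝ≥0) (l : PowerSeries ℂ) :
    wnorm r l = ∑' k : ℕ, ‖PowerSeries.coeff k l‖ₑ * (r : ℝ≥0∞) ^ k := by
  unfold wnorm
  rw [← (Finsupp.uniqueLinearEquiv ℕ ℕ ()).toEquiv.symm.tsum_eq]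
  refine tsum_congr fun k => ?_
  have : (Finsupp.uniqueLinearEquiv ℕ ℕ ()).toEquiv.symm k = Finsupp.single () k := by
    ext; simp
  rw [this, Finsupp.degree_single]
  rfl

variable {σ : Type*} {u : MvPowerSeries σ ℂ}

theorem subst_eq_powSum (hu : MvPowerSeries.constantCoeff u = 0) (l : PowerSeries ℂ) :
    l.subst u = powSum u fun k => MvPowerSeries.C (PowerSeries.coeff k l) := by
  ext m
  rw [PowerSeries.coeff_subst (.of_constantCoeff_zero hu),
    coeff_powSum hu _ (n := m.degree + 1) (by omega),
    finsum_eq_sum_of_support_subset (s := Finset.range (m.degree + 1))]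
  · refine Finset.sum_congr rfl fun k _ => ?_
    rw [mul_comm, MvPowerSeries.coeff_C_mul, smul_eq_mul]
  · intro k hk
    rw [Finset.coe_range, Set.mem_Iio]
    by_contra h
    refine hk ?_
    have := coeff_pow_mul_eq_zero hu 1 (m := m) (k := k) (by omega)
    rw [mul_one] at this
    simp only [this, smul_zero]

theorem IsConvergent.subst (hu : MvPowerSeries.constantCoeff u = 0) (huc : IsConvergent u)
    {l : PowerSeries ℂ} (hl : IsConvergent l) : IsConvergent (l.subst u) := by
  obtain ⟨r, hr, hl⟩ := isConvergent_iff_wnorm.1 hl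
  rw [subst_eq_powSum hu]
  refine isConvergent_powSum hu huc one_pos hl r⁻¹ fun k => ?_
  rw [← MvPowerSeries.monomial_zero_eq_C_apply, wnorm_monomial, map_zero, pow_zero, mul_one]
  have h1 : ‖PowerSeries.coeff k l‖ₑ * (r : ℝ≥0∞) ^ k ≤ wnorm r l := by
    rw [wnorm_powerSeries]
    exact ENNReal.le_tsum (f := fun k => ‖PowerSeries.coeff k l‖ₑ * (r : ℝ≥0∞) ^ k) k
  have h0 : (r : ℝ≥0∞) ≠ 0 := by simpa using hr.ne'
  calc ‖PowerSeries.coeff k l‖ₑ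
      = ‖PowerSeries.coeff k l‖ₑ * (r : ℝ≥0∞) ^ k * ((r : ℝ≥0∞)⁻¹) ^ k := by
        rw [mul_assoc, ← mul_pow, ENNReal.mul_inv_cancel h0 ENNReal.coe_ne_top, one_pow, mul_one]
    _ ≤ wnorm r l * ((r : ℝ≥0∞)⁻¹) ^ k := by gcongr
    _ = _ := by rw [ENNReal.coe_inv hr.ne']

/-- A series `l(h)` in a quasi-homogeneous polynomial `h` converges only if `l` does. -/
theorem isConvergent_of_subst {p : Fin 2 → ℕ} {δ : ℕ} (hδ : δ ≠ 0)
    {h : MvPolynomial (Fin 2) ℂ} (hh : MvPolynomial.IsWeightedHomogeneous p h δ) (hne : h ≠ 0)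
    (h0 : MvPolynomial.constantCoeff h = 0) {l : PowerSeries ℂ}
    (hl : IsConvergent (l.subst (h : FormalO2))) : IsConvergent l := by
  obtain ⟨r, hr, hf⟩ := isConvergent_iff_wnorm.1 hl
  set c := (MonomialOrder.lex (σ := Fin 2)).leadingCoeff h
  have hc : c ≠ 0 := MonomialOrder.leadingCoeff_ne_zero_iff.2 hne
  set d := (MonomialOrder.lex (σ := Fin 2)).degree h
  have hwd : Finsupp.weight p d = δ := hh hc
  -- `h ^ j` has weight `j * δ` and the exponent `k • d` has weight `k * δ`, so only `j = k`
  -- contributes. There the coefficient is the leading one of `h ^ k`, and leading coefficients are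
  -- multiplicative.
  have hcoeff : ∀ k, MvPowerSeries.coeff (k • d) (l.subst (h : FormalO2)) =
      PowerSeries.coeff k l * c ^ k := by
    intro k
    rw [PowerSeries.coeff_subst (hasSubst_coe h0), finsum_eq_single _ k]
    · rw [← MvPolynomial.coe_pow, MvPolynomial.coeff_coe, MonomialOrder.coeff_pow_nsmul_degree,
        smul_eq_mul]
    · intro j hj
      rw [← MvPolynomial.coe_pow, MvPolynomial.coeff_coe]
      by_contra hne
      have h1 := (hh.pow j) (right_ne_zero_of_smul hne)
      rw [map_nsmul, hwd, smul_eq_mul, smul_eq_mul] at h1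
      exact hj (Nat.eq_of_mul_eq_mul_right (Nat.pos_of_ne_zero hδ) h1.symm)
  -- At this radius the norm of `l` is exactly the part of the norm of `l(h)` at radius `r` carried
  -- by the exponents `k • d`.
  refine isConvergent_iff_wnorm.2 ⟨‖c‖₊ * r ^ d.degree,
    mul_pos (nnnorm_pos.2 hc) (pow_pos hr _), ne_top_of_le_ne_top hf ?_⟩
  rw [wnorm_powerSeries]
  have hinj : Function.Injective fun k : ℕ => k • d := by
    intro j k hjk
    have h1 := congrArg (Finsupp.weight p) hjk
    simp only [map_nsmul, hwd, smul_eq_mul] at h1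
    exact Nat.eq_of_mul_eq_mul_right (Nat.pos_of_ne_zero hδ) h1
  refine le_trans (le_of_eq (tsum_congr fun k => ?_)) (ENNReal.tsum_comp_le_tsum_of_injective hinj
    fun m => ‖MvPowerSeries.coeff m (l.subst (h : FormalO2))‖ₑ * (r : ℝ≥0∞) ^ m.degree)
  rw [hcoeff, map_nsmul, enorm_mul, enorm_pow, smul_eq_mul, mul_comm k, pow_mul, mul_assoc,
    ← mul_pow]
  push_cast
  rfl

theorem IsConvergent.tail {l : PowerSeries ℂ} (hl : IsConvergent l) :
    IsConvergent (HamiltonianCokernel.shift () 1 l : PowerSeries ℂ) := hl.shift () 1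

theorem eq_C_add_X_mul_tail (l : PowerSeries ℂ) :
    l = PowerSeries.C (PowerSeries.constantCoeff l) + PowerSeries.X * (shift () 1 l : PowerSeries ℂ) := by
  have h1 : PowerSeries.C (PowerSeries.constantCoeff l) = freeOf () l := by
    classical
    refine MvPowerSeries.ext fun m => ?_
    rw [coeff_freeOf]
    have hm : m = Finsupp.single () (m ()) := by ext; simp
    rw [hm]
    change PowerSeries.coeff (m ()) (PowerSeries.C (PowerSeries.constantCoeff l)) = _
    rw [PowerSeries.coeff_C]
    simp only [Finsupp.single_eq_same]
    split_ifs with h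
    · rw [h, Finsupp.single_zero]; rfl
    · rfl
  rw [h1]
  exact (freeOf_add_X_mul_shift () l).symm

end OneVariable

/-! ### The Euler derivation and division by `h` -/

section Euler

/-- The `u`-adic topology is separated, because `u ^ n` has order at least `n`. -/
theorem eq_of_forall_pow_dvd_sub {σ : Type*} {u f g : MvPowerSeries σ ℂ}
    (hu : MvPowerSeries.constantCoeff u = 0) (h : ∀ n : ℕ, u ^ n ∣ f - g) : f = g := by
  ext m
  obtain ⟨v, hv⟩ := h (m.degree + 1)
  rw [← sub_eq_zero, ← map_sub, hv]
  exact coeff_pow_mul_eq_zero hu v (by omega)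

theorem X_ne_zero {σ : Type*} (i : σ) : (MvPowerSeries.X i : MvPowerSeries σ ℂ) ≠ 0 := fun h => by
  have := MvPowerSeries.coeff_index_single_self_X (R := ℂ) i
  rw [h, map_zero] at this
  exact zero_ne_one this

/-- A partial derivative of a polynomial, as a power series. -/
def jac (h : MvPolynomial (Fin 2) ℂ) (i : Fin 2) : FormalO2 :=
  (MvPolynomial.pderiv i h : MvPolynomial (Fin 2) ℂ)

theorem isConvergent_jac (h : MvPolynomial (Fin 2) ℂ) (i : Fin 2) : IsConvergent (jac h i) :=
  IsConvergent.coe _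

theorem pderiv_coe_eq_jac (h : MvPolynomial (Fin 2) ℂ) (i : Fin 2) :
    MvPowerSeries.pderiv ℂ i (h : FormalO2) = jac h i := MvPowerSeries.pderiv_coe h

/-- The Hamiltonian derivation `h_j ∂_i - h_i ∂_j`. -/
def ham (h : MvPolynomial (Fin 2) ℂ) (i j : Fin 2) : Derivation ℂ FormalO2 FormalO2 :=
  jac h j • MvPowerSeries.pderiv ℂ i - jac h i • MvPowerSeries.pderiv ℂ j

theorem ham_apply (h : MvPolynomial (Fin 2) ℂ) (i j : Fin 2) (f : FormalO2) :
    ham h i j f = jac h j * MvPowerSeries.pderiv ℂ i f - jac h i * MvPowerSeries.pderiv ℂ j f :=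
  rfl

theorem ham_swap (h : MvPolynomial (Fin 2) ℂ) (i j : Fin 2) (f : FormalO2) :
    ham h j i f = -ham h i j f := by
  simp only [ham_apply]; ring

theorem ham_coe (h : MvPolynomial (Fin 2) ℂ) (i j : Fin 2) : ham h i j (h : FormalO2) = 0 := by
  rw [ham_apply, pderiv_coe_eq_jac, pderiv_coe_eq_jac]; ring

theorem ham_const (h : MvPolynomial (Fin 2) ℂ) (i j : Fin 2) (c : ℂ) :
    ham h i j (MvPowerSeries.C c) = 0 := by
  rw [ham_apply, MvPowerSeries.pderiv_C, MvPowerSeries.pderiv_C]; ring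

theorem ham_coe_mul (h : MvPolynomial (Fin 2) ℂ) (i j : Fin 2) (f : FormalO2) :
    ham h i j ((h : FormalO2) * f) = h * ham h i j f := by
  rw [Derivation.leibniz, ham_coe, smul_zero, add_zero, smul_eq_mul]

theorem formalX0_eq_ham (δ : ℕ) (h : MvPolynomial (Fin 2) ℂ) (f : FormalO2) :
    formalX0 δ h f = (δ : ℂ)⁻¹ • ham h 0 1 f := rfl

theorem weight_fin_two (p : Fin 2 → ℕ) {i j : Fin 2} (hij : i ≠ j) (m : Fin 2 →₀ ℕ) :
    Finsupp.weight p m = m i * p i + m j * p j := by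
  rw [Finsupp.weight_apply, Finsupp.sum_fintype _ _ (by simp), Fin.sum_univ_two]
  simp only [smul_eq_mul]
  fin_cases i <;> fin_cases j <;> first | exact absurd rfl hij | (simp; try omega)

theorem coeff_X_mul_pderiv (i : Fin 2) (f : FormalO2) (m : Fin 2 →₀ ℕ) :
    MvPowerSeries.coeff m (MvPowerSeries.X i * MvPowerSeries.pderiv ℂ i f) =
      (m i : ℂ) * MvPowerSeries.coeff m f := by
  rw [← pow_one (MvPowerSeries.X i)]
  rcases Nat.eq_zero_or_pos (m i) with h | h
  · rw [coeff_X_pow_mul_of_lt i _ (by omega), h]; simp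
  · obtain ⟨k, rfl⟩ := exists_eq_add_single (n := 1) h
    rw [coeff_X_pow_mul_add, MvPowerSeries.coeff_pderiv]
    simp [mul_comm]

/-- The Euler derivation of weight `p`. -/
def euler (p : Fin 2 → ℕ) (f : FormalO2) : FormalO2 :=
  diag (fun m => (Finsupp.weight p m : ℂ)) f

theorem euler_eq (p : Fin 2 → ℕ) {i j : Fin 2} (hij : i ≠ j) (f : FormalO2) :
    euler p f = (p i : FormalO2) * (MvPowerSeries.X i * MvPowerSeries.pderiv ℂ i f) +
      (p j : FormalO2) * (MvPowerSeries.X j * MvPowerSeries.pderiv ℂ j f) := by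
  ext m
  have hC : ∀ n : ℕ, (n : FormalO2) = MvPowerSeries.C (n : ℂ) := fun n => by simp
  rw [euler, coeff_diag, map_add, hC, hC, MvPowerSeries.coeff_C_mul, MvPowerSeries.coeff_C_mul,
    coeff_X_mul_pderiv, coeff_X_mul_pderiv, weight_fin_two p hij]
  push_cast; ring

theorem euler_mul (p : Fin 2 → ℕ) (f g : FormalO2) :
    euler p (f * g) = euler p f * g + f * euler p g := by
  have h01 : (0 : Fin 2) ≠ 1 := by decide
  simp only [euler_eq p h01, Derivation.leibniz, smul_eq_mul]
  ring

theorem euler_sub (p : Fin 2 → ℕ) (f g : FormalO2) :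
    euler p (f - g) = euler p f - euler p g := by
  have h01 : (0 : Fin 2) ≠ 1 := by decide
  simp only [euler_eq p h01, map_sub]
  ring

/-- The operator `E + n` is diagonal with entries `weight + n`, so it is inverted coefficient by
coefficient. It is used with `n = δ` and with `n` a nonzero weight. -/
theorem euler_add_natCast_mul (p : Fin 2 → ℕ) {n : ℕ} (f : FormalO2)
    (hn : ∀ m : Fin 2 →₀ ℕ, Finsupp.weight p m + n ≠ 0) :
    euler p (diag (fun m => ((Finsupp.weight p m + n : ℕ) : ℂ)⁻¹) f) +
      (n : FormalO2) * diag (fun m => ((Finsupp.weight p m + n : ℕ) : ℂ)⁻¹) f = f := by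
  ext m
  have hC : (n : FormalO2) = MvPowerSeries.C (n : ℂ) := by simp
  rw [map_add, hC, MvPowerSeries.coeff_C_mul, euler, coeff_diag, coeff_diag]
  have : ((Finsupp.weight p m + n : ℕ) : ℂ) ≠ 0 := Nat.cast_ne_zero.2 (hn m)
  field_simp
  push_cast; ring

theorem nnnorm_inv_natCast_le_one (n : ℕ) : ‖((n : ℕ) : ℂ)⁻¹‖₊ ≤ 1 := by
  rcases Nat.eq_zero_or_pos n with rfl | h
  · simp
  · rw [nnnorm_inv, RCLike.nnnorm_natCast]
    exact inv_le_one_of_one_le₀ (by exact_mod_cast h)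

variable {p : Fin 2 → ℕ} {δ : ℕ} {h : MvPolynomial (Fin 2) ℂ}

/-- Euler's identity. -/
theorem euler_coe (hh : MvPolynomial.IsWeightedHomogeneous p h δ) :
    euler p (h : FormalO2) = (δ : FormalO2) * (h : FormalO2) := by
  ext m
  have hC : (δ : FormalO2) = MvPowerSeries.C (δ : ℂ) := by simp
  rw [euler, coeff_diag, hC, MvPowerSeries.coeff_C_mul, MvPolynomial.coeff_coe]
  by_cases hm : MvPolynomial.coeff m h = 0
  · simp [hm]
  · rw [hh hm]

theorem euler_jac (hh : MvPolynomial.IsWeightedHomogeneous p h δ) {i j : Fin 2} (hij : i ≠ j) :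
    (p i : FormalO2) * (MvPowerSeries.X i * jac h i) +
      (p j : FormalO2) * (MvPowerSeries.X j * jac h j) = (δ : FormalO2) * (h : FormalO2) := by
  rw [← euler_coe hh, euler_eq p hij, pderiv_coe_eq_jac, pderiv_coe_eq_jac]

/-- Powers of both variables lie in the Jacobian ideal. -/
def JacobianPrimary (h : MvPolynomial (Fin 2) ℂ) (N : ℕ) : Prop :=
  ∀ i, ∃ A B : FormalO2, IsConvergent A ∧ IsConvergent B ∧
    MvPowerSeries.X i ^ N = A * jac h 0 + B * jac h 1

/-- Cramer's rule for the two equations defining `H w` and `E w` shows that `h` divides `E w` after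
multiplication by any element of the Jacobian ideal, in particular by `X 0 ^ N` and `X 1 ^ N`. These
powers are coprime, so they can be removed. -/
theorem euler_dvd (hh : MvPolynomial.IsWeightedHomogeneous p h δ) (hne : h ≠ 0) {N : ℕ}
    (hN : JacobianPrimary h N) {w g : FormalO2} (hw : ham h 0 1 w = h * g) :
    ∃ s, euler p w = h * s ∧ (IsConvergent w → IsConvergent g → IsConvergent s) := by
  have h01 : (0 : Fin 2) ≠ 1 := by decide
  have hne' : (h : FormalO2) ≠ 0 := fun h0 => hne (MvPolynomial.coe_injective _ _ (by simpa using h0))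
  have hE := euler_jac hh h01
  rw [ham_apply] at hw
  set wx := MvPowerSeries.pderiv ℂ 0 w with hwx
  set wy := MvPowerSeries.pderiv ℂ 1 w with hwy
  -- The quotients of `h_x E w` and `h_y E w` by `h`, found by eliminating one term of Euler's
  -- identity.
  set a : FormalO2 := (δ : FormalO2) * wx - (p 1 : FormalO2) * MvPowerSeries.X 1 * g with ha
  set b : FormalO2 := (δ : FormalO2) * wy + (p 0 : FormalO2) * MvPowerSeries.X 0 * g with hb
  have h1 : jac h 0 * euler p w = h * a := by
    rw [euler_eq p h01, ha]
    linear_combination wx * hE - (p 1 : FormalO2) * MvPowerSeries.X 1 * hw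
  have h2 : jac h 1 * euler p w = h * b := by
    rw [euler_eq p h01, hb]
    linear_combination wy * hE + (p 0 : FormalO2) * MvPowerSeries.X 0 * hw
  obtain ⟨A, B, hA, hB, hAB⟩ := hN 0
  obtain ⟨A', B', hA', hB', hAB'⟩ := hN 1
  have h3 : MvPowerSeries.X 0 ^ N * euler p w = (h : FormalO2) * (A * a + B * b) := by
    rw [hAB]; linear_combination A * h1 + B * h2
  have h4 : MvPowerSeries.X 1 ^ N * euler p w = (h : FormalO2) * (A' * a + B' * b) := by
    rw [hAB']; linear_combination A' * h1 + B' * h2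
  -- Two expressions for `X 0 ^ N * X 1 ^ N * E w`, with `h` cancelled; hence `X 0 ^ N` divides `A *
  -- a + B * b`.
  have h5 : MvPowerSeries.X 1 ^ N * (A * a + B * b) =
      MvPowerSeries.X 0 ^ N * (A' * a + B' * b) := by
    apply mul_left_cancel₀ hne'
    linear_combination MvPowerSeries.X 0 ^ N * h4 - MvPowerSeries.X 1 ^ N * h3
  have h6 := X_pow_dvd_of_mul_eq h01 h5
  refine ⟨shift 0 N (A * a + B * b), ?_, fun hw hg => ?_⟩
  · apply mul_left_cancel₀ (pow_ne_zero N (X_ne_zero (0 : Fin 2)))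
    rw [h3]
    linear_combination -(h : FormalO2) * h6
  · have hn : ∀ n : ℕ, IsConvergent (n : FormalO2) := fun n =>
      (convergentSeries (Fin 2)).natCast_mem n
    refine IsConvergent.shift (.add (hA.mul (.sub ?_ ?_)) (hB.mul (.add ?_ ?_))) 0 N
    · exact (hn _).mul (hw.pderiv 0)
    · exact ((hn _).mul (.X 1)).mul hg
    · exact (hn _).mul (hw.pderiv 1)
    · exact ((hn _).mul (.X 0)).mul hg

/-- Every function whose Euler derivative vanishes and which the Hamiltonian derivation maps in
the ideal `(h)` is constant. -/
def EulerKernelConst (p : Fin 2 → ℕ) (h : MvPolynomial (Fin 2) ℂ) : Prop :=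
  ∀ q g : FormalO2, euler p q = 0 → ham h 0 1 q = h * g → ∃ c, q = MvPowerSeries.C c

/-- The division step behind both the kernel (`g = 0`, iterated) and the torsion-freeness of the
cokernel. The correction `w - h t` is killed by `E` and sent by `H` into `(h)`, which is what
`EulerKernelConst` requires. -/
theorem exists_eq_const_add_mul (hh : MvPolynomial.IsWeightedHomogeneous p h δ) (hδ : δ ≠ 0)
    (hne : h ≠ 0) {N : ℕ} (hN : JacobianPrimary h N) (hK : EulerKernelConst p h)
    {w g : FormalO2} (hw : ham h 0 1 w = h * g) :
    ∃ c t, w = MvPowerSeries.C c + (h : FormalO2) * t ∧ ham h 0 1 t = g ∧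
      (IsConvergent w → IsConvergent g → IsConvergent t) := by
  have hne' : (h : FormalO2) ≠ 0 := fun h0 => hne (MvPolynomial.coe_injective _ _ (by simpa using h0))
  obtain ⟨s, hs, hsc⟩ := euler_dvd hh hne hN hw
  -- Since `E h = δ h`, one has `E (h t) = h (E + δ) t`, so `t` must solve `(E + δ) t = s`.
  have hinv := euler_add_natCast_mul p s (n := δ) (fun m => by omega)
  set t := diag (fun m => ((Finsupp.weight p m + δ : ℕ) : ℂ)⁻¹) s
  have h1 : euler p (w - h * t) = 0 := by
    rw [euler_sub, euler_mul, euler_coe hh, hs]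
    linear_combination -(h : FormalO2) * hinv
  obtain ⟨c, hc⟩ := hK _ (g - ham h 0 1 t) h1 (by rw [map_sub, ham_coe_mul, hw]; ring)
  have hwt : w = MvPowerSeries.C c + (h : FormalO2) * t := by rw [← hc]; ring
  refine ⟨c, t, hwt, ?_, fun hw hg => ?_⟩
  · apply mul_left_cancel₀ hne'
    rw [← hw, hwt, map_add, ham_const, zero_add, ham_coe_mul]
  · exact (hsc hw hg).diag fun m => nnnorm_inv_natCast_le_one _

/-- The kernel of the Hamiltonian derivation of the formal power series consists of series
in `h`. -/
theorem exists_subst_of_ham_eq_zero (hh : MvPolynomial.IsWeightedHomogeneous p h δ) (hδ : δ ≠ 0)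
    (h0 : MvPolynomial.constantCoeff h = 0)
    (hne : h ≠ 0) {N : ℕ} (hN : JacobianPrimary h N) (hK : EulerKernelConst p h)
    {w : FormalO2} (hw : ham h 0 1 w = 0) : ∃ l : PowerSeries ℂ, l.subst (h : FormalO2) = w := by
  have hu : MvPowerSeries.constantCoeff (h : FormalO2) = 0 := by
    rw [← MvPowerSeries.coeff_zero_eq_constantCoeff_apply, MvPolynomial.coeff_coe]; exact h0
  have step : ∀ w : {w : FormalO2 // ham h 0 1 w = 0}, ∃ (c : ℂ)
      (t : {w : FormalO2 // ham h 0 1 w = 0}), (w : FormalO2) = MvPowerSeries.C c + (h : FormalO2) * (t : FormalO2) := by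
    rintro ⟨w, hw⟩
    obtain ⟨c, t, h1, h2, -⟩ := exists_eq_const_add_mul hh hδ hne hN hK (w := w) (g := 0)
      (by rw [hw, mul_zero])
    exact ⟨c, ⟨t, h2⟩, h1⟩
  choose c t ht using step
  set w0 : {w : FormalO2 // ham h 0 1 w = 0} := ⟨w, hw⟩
  -- The `k`-th coefficient is the constant split off at the `k`-th division; after `n` divisions
  -- the error is a multiple of `h ^ n`.
  refine ⟨PowerSeries.mk fun k => c (t^[k] w0), eq_of_forall_pow_dvd_sub hu fun n => ?_⟩
  have hsum : ∀ n, w = ∑ k ∈ Finset.range n, (h : FormalO2) ^ k * MvPowerSeries.C (c (t^[k] w0)) +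
      (h : FormalO2) ^ n * (t^[n] w0 : FormalO2) := by
    intro n
    induction n with
    | zero => simp [w0]
    | succ n ih =>
      rw [Finset.sum_range_succ, Function.iterate_succ_apply']
      conv_lhs => rw [ih]
      rw [ht (t^[n] w0)]
      ring
  rw [subst_eq_powSum hu, powSum_eq_sum_add hu _ n]
  simp only [PowerSeries.coeff_mk]
  conv => rhs; rhs; rw [hsum n]
  rw [add_sub_add_left_eq_sub, ← mul_sub]
  exact dvd_mul_right _ _

end Euler

/-! ### Consequences of an isolated singularity: positive weights and the node -/

section Singularity

variable {p : Fin 2 → ℕ} {δ : ℕ} {h : MvPolynomial (Fin 2) ℂ}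

theorem eval_single_eq_zero {q : MvPolynomial (Fin 2) ℂ} {j : Fin 2}
    (hq : ∀ n, MvPolynomial.coeff (Finsupp.single j n) q = 0) (t : ℂ) :
    MvPolynomial.eval (Pi.single j t : Fin 2 → ℂ) q = 0 := by
  rw [MvPolynomial.eval_eq']
  refine Finset.sum_eq_zero fun d hd => ?_
  obtain ⟨i, hij, hi⟩ : ∃ i, i ≠ j ∧ d i ≠ 0 := by
    by_contra! hz
    refine MvPolynomial.mem_support_iff.1 hd ?_
    have : d = Finsupp.single j (d j) := by
      ext i
      rcases eq_or_ne i j with rfl | hij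
      · simp
      · rw [hz i hij, Finsupp.single_eq_of_ne hij]
    rw [this]; exact hq _
  rw [Finset.prod_eq_zero (Finset.mem_univ i), mul_zero]
  rw [Pi.single_eq_of_ne hij, zero_pow hi]

theorem coeff_single_eq_zero (hs : IsIsolatedSingularity h) (k : Fin 2) :
    MvPolynomial.coeff (Finsupp.single k 1) h = 0 := by
  have h1 := hs.1 k
  rw [MvPolynomial.eval_zero, MvPolynomial.constantCoeff_eq, MvPolynomial.coeff_pderiv] at h1
  simpa using h1

/-- Along each axis, some partial derivative of `h` is not identically zero. -/
theorem exists_coeff_ne_zero (hs : IsIsolatedSingularity h) (j : Fin 2) :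
    ∃ n k, n ≠ 0 ∧ MvPolynomial.coeff (Finsupp.single j n + Finsupp.single k 1) h ≠ 0 := by
  by_contra! hz
  have hcrit : ∀ t : ℂ, ∀ k, MvPolynomial.eval (Pi.single j t : Fin 2 → ℂ)
      (MvPolynomial.pderiv k h) = 0 := by
    intro t k
    refine eval_single_eq_zero (fun n => ?_) t
    rw [MvPolynomial.coeff_pderiv]
    rcases eq_or_ne n 0 with rfl | hn
    · rw [Finsupp.single_zero, zero_add, coeff_single_eq_zero hs, zero_mul]
    · rw [hz n k hn, zero_mul]
  have hlim : Tendsto (fun t : ℂ => (Pi.single j t : Fin 2 → ℂ)) (𝓝[≠] 0) (𝓝[≠] 0) := by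
    refine tendsto_nhdsWithin_iff.mpr ⟨?_, ?_⟩
    · have hc : Continuous fun t : ℂ => (Pi.single j t : Fin 2 → ℂ) :=
        continuous_pi fun i => by
          rcases eq_or_ne i j with rfl | hij
          · simpa using continuous_id'
          · simpa [hij] using continuous_const
      have := hc.tendsto 0
      rw [Pi.single_zero] at this
      exact this.mono_left nhdsWithin_le_nhds
    · filter_upwards [self_mem_nhdsWithin] with t ht
      simpa using ht
  obtain ⟨t, k, hk⟩ := (hlim.eventually hs.2).exists
  exact hk (hcrit t k)

theorem ne_zero_of_isIsolatedSingularity (hs : IsIsolatedSingularity h) : h ≠ 0 := by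
  rintro rfl
  obtain ⟨n, k, -, hk⟩ := exists_coeff_ne_zero hs 0
  simp at hk

theorem exists_weight_eq (hh : MvPolynomial.IsWeightedHomogeneous p h δ)
    (hs : IsIsolatedSingularity h) (j : Fin 2) :
    ∃ n k, n ≠ 0 ∧ MvPolynomial.coeff (Finsupp.single j n + Finsupp.single k 1) h ≠ 0 ∧
      n * p j + p k = δ := by
  obtain ⟨n, k, hn, hk⟩ := exists_coeff_ne_zero hs j
  refine ⟨n, k, hn, hk, ?_⟩
  have := hh hk
  rw [map_add, Finsupp.weight_single, Finsupp.weight_single] at this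
  simpa using this

/-- Coprime weights are not both zero, and the axis of a variable of nonzero weight carries a
monomial of `h` that involves this variable. -/
theorem degree_ne_zero (hp : Nat.Coprime (p 0) (p 1))
    (hh : MvPolynomial.IsWeightedHomogeneous p h δ) (hs : IsIsolatedSingularity h) : δ ≠ 0 := by
  obtain ⟨j, hj⟩ : ∃ j, p j ≠ 0 := by
    by_contra! hz
    rw [hz 0, hz 1] at hp
    norm_num at hp
  obtain ⟨n, k, hn, -, hk⟩ := exists_weight_eq hh hs j
  have := Nat.mul_ne_zero hn hj
  omega

/-- The factor `t ^ p k` stands on the left to avoid the truncated difference `δ - p k`. -/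
theorem weightedHomogeneous_eval_pderiv (hh : MvPolynomial.IsWeightedHomogeneous p h δ)
    (k : Fin 2) (z : Fin 2 → ℂ) (t : ℂ) :
    t ^ p k * MvPolynomial.eval (fun i => t ^ p i * z i) (MvPolynomial.pderiv k h) =
      t ^ δ * MvPolynomial.eval z (MvPolynomial.pderiv k h) := by
  rw [MvPolynomial.eval_eq', MvPolynomial.eval_eq', Finset.mul_sum, Finset.mul_sum]
  refine Finset.sum_congr rfl fun d hd => ?_
  have hd := MvPolynomial.mem_support_iff.1 hd
  rw [MvPolynomial.coeff_pderiv] at hd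
  have hw := hh (left_ne_zero_of_mul hd)
  rw [map_add, Finsupp.weight_single, weight_fin_two p (by decide : (0 : Fin 2) ≠ 1)] at hw
  rw [← hw, Fin.prod_univ_two, Fin.prod_univ_two]
  simp only [mul_pow, pow_add, ← pow_mul, one_smul]
  rw [mul_comm (d 0), mul_comm (d 1)]
  ring

/-- The critical set is stable under the weighted scaling, and positive weights contract each orbit
to the origin. A critical point elsewhere would yield critical points arbitrarily near the origin.
-/
theorem eq_zero_of_critical (hp : ∀ i, p i ≠ 0)
    (hh : MvPolynomial.IsWeightedHomogeneous p h δ) (hs : IsIsolatedSingularity h)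
    {z : Fin 2 → ℂ} (hz : ∀ k, MvPolynomial.eval z (MvPolynomial.pderiv k h) = 0) : z = 0 := by
  by_contra hne
  have hlim : Tendsto (fun t : ℂ => fun i => t ^ p i * z i) (𝓝[≠] 0) (𝓝[≠] 0) := by
    refine tendsto_nhdsWithin_iff.mpr ⟨?_, ?_⟩
    · have hc : Continuous fun t : ℂ => fun i => t ^ p i * z i := by fun_prop
      have := hc.tendsto 0
      have h0 : (fun i => (0 : ℂ) ^ p i * z i) = 0 := by
        funext i; simp [hp i]
      rw [h0] at this
      exact this.mono_left nhdsWithin_le_nhds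
    · filter_upwards [self_mem_nhdsWithin] with t ht h0
      refine hne (funext fun i => ?_)
      have := congrFun h0 i
      simpa [hp i, show t ≠ 0 from ht] using this
  obtain ⟨t, ht, k, hk⟩ := ((eventually_mem_nhdsWithin).and (hlim.eventually hs.2)).exists
  have h1 := weightedHomogeneous_eval_pderiv hh k z t
  rw [hz k, mul_zero] at h1
  exact hk ((mul_eq_zero.1 h1).resolve_left (pow_ne_zero _ ht))

/-- The zero locus of the polynomial Jacobian ideal is at most the origin, so the Nullstellensatz
puts both variables in its radical. -/
theorem jacobianPrimary_of_weights_ne_zero (hp : ∀ i, p i ≠ 0)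
    (hh : MvPolynomial.IsWeightedHomogeneous p h δ) (hs : IsIsolatedSingularity h) :
    ∃ N, JacobianPrimary h N := by
  set J : Ideal (MvPolynomial (Fin 2) ℂ) :=
    Ideal.span {MvPolynomial.pderiv 0 h, MvPolynomial.pderiv 1 h} with hJ
  have hrad : ∀ i, ∃ n : ℕ, (MvPolynomial.X i : MvPolynomial (Fin 2) ℂ) ^ n ∈ J := by
    intro i
    have : (MvPolynomial.X i : MvPolynomial (Fin 2) ℂ) ∈ J.radical := by
      rw [← MvPolynomial.vanishingIdeal_zeroLocus_eq_radical (K := ℂ),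
        MvPolynomial.mem_vanishingIdeal_iff]
      intro z hz
      have hz0 : z = 0 := eq_zero_of_critical hp hh hs fun k => by
        have := hz (MvPolynomial.pderiv k h) (Ideal.subset_span (by fin_cases k <;> simp))
        rwa [MvPolynomial.aeval_eq_eval] at this
      simp [hz0]
    exact this
  choose n hn using hrad
  -- A common exponent for the two variables.
  refine ⟨n 0 + n 1, fun i => ?_⟩
  obtain ⟨a, b, hab⟩ := Ideal.mem_span_pair.1 (hn i)
  obtain ⟨k, hk⟩ : ∃ k, n 0 + n 1 = k + n i := by
    fin_cases i
    · exact ⟨n 1, add_comm _ _⟩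
    · exact ⟨n 0, rfl⟩
  refine ⟨MvPowerSeries.X i ^ k * (a : FormalO2), MvPowerSeries.X i ^ k * (b : FormalO2),
    ((IsConvergent.X i).pow k).mul (.coe a), ((IsConvergent.X i).pow k).mul (.coe b), ?_⟩
  have h1 : (a : FormalO2) * jac h 0 + (b : FormalO2) * jac h 1 = MvPowerSeries.X i ^ n i := by
    have := congrArg (fun q : MvPolynomial (Fin 2) ℂ => (q : FormalO2)) hab
    simpa [jac] using this
  rw [hk, pow_add, ← h1]
  ring

theorem eulerKernelConst_of_weights_ne_zero (hp : ∀ i, p i ≠ 0) : EulerKernelConst p h := by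
  classical
  intro q _ hq _
  refine ⟨MvPowerSeries.constantCoeff q, ?_⟩
  ext m
  rw [MvPowerSeries.coeff_C]
  split_ifs with hm
  · rw [hm]; rfl
  · have h1 := congrArg (MvPowerSeries.coeff m) hq
    rw [euler, coeff_diag, map_zero] at h1
    refine (mul_eq_zero.1 h1).resolve_left (Nat.cast_ne_zero.2 fun hw => hm ?_)
    rw [weight_fin_two p (by decide : (0 : Fin 2) ≠ 1)] at hw
    have h0 := hp 0
    have h1 := hp 1
    have h2 := (Nat.add_eq_zero_iff.1 hw)
    have h3 := (Nat.mul_eq_zero.1 h2.1).resolve_right h0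
    have h4 := (Nat.mul_eq_zero.1 h2.2).resolve_right h1
    ext i; fin_cases i <;> assumption

/-- The polynomial `h` is the product of the two variables and a unit that involves only the
variable `i`. -/
structure IsNode (h : MvPolynomial (Fin 2) ℂ) (i j : Fin 2) (u : FormalO2) : Prop where
  ne : i ≠ j
  isConvergent : IsConvergent u
  constantCoeff_ne_zero : MvPowerSeries.constantCoeff u ≠ 0
  coeff_eq_zero : ∀ m : Fin 2 →₀ ℕ, m j ≠ 0 → MvPowerSeries.coeff m u = 0
  eq : (h : FormalO2) = MvPowerSeries.X i * MvPowerSeries.X j * u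

/-- The weights force `δ = 1`, so `h` is `X j` times a polynomial in `X i`. That polynomial vanishes
at `0` because `h` has no linear term, and only to first order because the `X j`-axis is not
critical. -/
theorem exists_isNode {i j : Fin 2} (hij : i ≠ j) (hi : p i = 0) (hj : p j = 1)
    (hδ : δ ≠ 0) (hh : MvPolynomial.IsWeightedHomogeneous p h δ) (hs : IsIsolatedSingularity h) :
    ∃ u, IsNode h i j u := by
  have hfin : ∀ k, k = i ∨ k = j := by
    intro k; fin_cases i <;> fin_cases j <;> fin_cases k <;> simp_all
  -- A monomial `X i ^ n * X k` has weight `p k`, which must be the nonzero `δ`; hence `k = j`.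
  have hδ1 : δ = 1 := by
    obtain ⟨n, k, -, -, hk⟩ := exists_weight_eq hh hs i
    rcases hfin k with rfl | rfl
    · rw [hi, mul_zero] at hk; exact absurd hk.symm hδ
    · rw [hi, hj, mul_zero] at hk; exact hk.symm
  have hc : MvPolynomial.coeff (Finsupp.single j 1 + Finsupp.single i 1) h ≠ 0 := by
    obtain ⟨n, k, hn, hk, hw⟩ := exists_weight_eq hh hs j
    rw [hj, mul_one, hδ1] at hw
    rcases hfin k with rfl | rfl
    · rw [hi] at hw
      obtain rfl : n = 1 := by omega
      exact hk
    · omega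
  have hsupp : ∀ m : Fin 2 →₀ ℕ, MvPolynomial.coeff m h ≠ 0 → m j = 1 := by
    intro m hm
    have := hh hm
    rwa [weight_fin_two p hij, hi, hj, hδ1, mul_zero, zero_add, mul_one] at this
  have hsupp' : ∀ m : Fin 2 →₀ ℕ, MvPolynomial.coeff m h ≠ 0 → m i ≠ 0 := by
    intro m hm h0
    refine hm ?_
    have : m = Finsupp.single j 1 := by
      ext k
      rcases hfin k with rfl | rfl
      · rw [h0, Finsupp.single_eq_of_ne hij]
      · rw [hsupp m hm]; simp
    rw [this, coeff_single_eq_zero hs]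
  refine ⟨shift i 1 (shift j 1 (h : FormalO2)), hij, ?_, ?_, ?_, ?_⟩
  · exact ((IsConvergent.coe h).shift j 1).shift i 1
  · rw [← MvPowerSeries.coeff_zero_eq_constantCoeff_apply, coeff_shift, coeff_shift,
      MvPolynomial.coeff_coe, zero_add, add_comm]
    exact hc
  · intro m hm
    rw [coeff_shift, coeff_shift, MvPolynomial.coeff_coe]
    by_contra h0
    have := hsupp _ h0
    simp [hij] at this
    omega
  · have h1 := X_pow_mul_shift (i := j) (n := 1) (f := (h : FormalO2)) fun m hm => by
      rw [MvPolynomial.coeff_coe]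
      by_contra h0
      have := hsupp _ h0
      omega
    have h2 := X_pow_mul_shift (i := i) (n := 1) (f := shift j 1 (h : FormalO2)) fun m hm => by
      rw [coeff_shift, MvPolynomial.coeff_coe]
      by_contra h0
      have := hsupp' _ h0
      simp [hij] at this
      omega
    rw [pow_one] at h1 h2
    rw [mul_right_comm, mul_assoc (MvPowerSeries.X i), mul_comm (MvPowerSeries.X i), mul_assoc]
    conv_lhs => rw [← h1, ← h2]
    ring

namespace IsNode

variable {i j : Fin 2} {u : FormalO2}

theorem pderiv_eq_zero {f : FormalO2} (hf : ∀ m : Fin 2 →₀ ℕ, m j ≠ 0 → MvPowerSeries.coeff m f = 0) :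
    MvPowerSeries.pderiv ℂ j f = 0 := by
  ext m
  rw [MvPowerSeries.coeff_pderiv, hf _ (by simp), zero_mul, map_zero]

/-- The derivative of `X i * u` with respect to the variable `i`. -/
theorem coeff_derivUnit_eq_zero (H : IsNode h i j u) {m : Fin 2 →₀ ℕ} (hm : m j ≠ 0) :
    MvPowerSeries.coeff m (u + MvPowerSeries.X i * MvPowerSeries.pderiv ℂ i u) = 0 := by
  rw [map_add, coeff_X_mul_pderiv, H.coeff_eq_zero m hm]; simp

theorem constantCoeff_derivUnit (_ : IsNode h i j u) :
    MvPowerSeries.constantCoeff (u + MvPowerSeries.X i * MvPowerSeries.pderiv ℂ i u) =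
      MvPowerSeries.constantCoeff u := by simp

theorem jac_snd (H : IsNode h i j u) : jac h j = MvPowerSeries.X i * u := by
  rw [← pderiv_coe_eq_jac, H.eq, Derivation.leibniz, Derivation.leibniz,
    pderiv_eq_zero H.coeff_eq_zero, MvPowerSeries.pderiv_X_self, MvPowerSeries.pderiv_X_of_ne H.ne]
  simp only [smul_eq_mul]; ring

theorem jac_fst (H : IsNode h i j u) : jac h i =
    MvPowerSeries.X j * (u + MvPowerSeries.X i * MvPowerSeries.pderiv ℂ i u) := by
  rw [← pderiv_coe_eq_jac, H.eq, Derivation.leibniz, Derivation.leibniz,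
    MvPowerSeries.pderiv_X_self, MvPowerSeries.pderiv_X_of_ne H.ne.symm]
  simp only [smul_eq_mul]; ring

theorem isConvergent_derivUnit (H : IsNode h i j u) :
    IsConvergent (u + MvPowerSeries.X i * MvPowerSeries.pderiv ℂ i u) :=
  H.isConvergent.add ((IsConvergent.X i).mul (H.isConvergent.pderiv i))

theorem fin_eq (H : IsNode h i j u) : (i = 0 ∧ j = 1) ∨ (i = 1 ∧ j = 0) := by
  have := H.ne
  fin_cases i <;> fin_cases j <;> simp_all

/-- Up to convergent units, the partial derivatives of a node are the two variables, so the exponent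
`1` suffices. -/
theorem jacobianPrimary (H : IsNode h i j u) : JacobianPrimary h 1 := by
  set v := u + MvPowerSeries.X i * MvPowerSeries.pderiv ℂ i u with hv
  have hv0 : MvPowerSeries.constantCoeff v ≠ 0 := by
    rw [H.constantCoeff_derivUnit]; exact H.constantCoeff_ne_zero
  have h1 : MvPowerSeries.X i = u⁻¹ * jac h j := by
    rw [H.jac_snd, mul_left_comm, MvPowerSeries.inv_mul_cancel _ H.constantCoeff_ne_zero, mul_one]
  have h2 : MvPowerSeries.X j = v⁻¹ * jac h i := by
    rw [H.jac_fst, mul_left_comm, MvPowerSeries.inv_mul_cancel _ hv0, mul_one]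
  have hu' := H.isConvergent.inv H.constantCoeff_ne_zero
  have hv' := H.isConvergent_derivUnit.inv hv0
  have hz : IsConvergent (0 : FormalO2) := (convergentSeries (Fin 2)).zero_mem
  rcases H.fin_eq with ⟨rfl, rfl⟩ | ⟨rfl, rfl⟩ <;> intro k <;> fin_cases k
  · exact ⟨0, u⁻¹, hz, hu', by simpa using h1⟩
  · exact ⟨v⁻¹, 0, hv', hz, by simpa using h2⟩
  · exact ⟨0, v⁻¹, hz, hv', by simpa using h2⟩
  · exact ⟨u⁻¹, 0, hu', hz, by simpa using h1⟩

theorem exists_ham_eq (H : IsNode h i j u) :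
    ∃ ε : ℂ, ∀ f, ham h i j f = ε • ham h 0 1 f := by
  rcases H.fin_eq with ⟨rfl, rfl⟩ | ⟨rfl, rfl⟩
  · exact ⟨1, fun f => by simp⟩
  · exact ⟨-1, fun f => by rw [ham_swap]; simp⟩

/-- Here `E` is `X j ∂_j`, whose kernel consists of all series in `X i`, so the condition on `H q`
is really needed. It forces `X j` to divide `∂_i q`, which does not involve `X j`; hence `∂_i q =
0`. -/
theorem eulerKernelConst (H : IsNode h i j u) (hi : p i = 0) (hj : p j = 1) :
    EulerKernelConst p h := by
  classical
  intro q g hq hg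
  obtain ⟨ε, hε⟩ := H.exists_ham_eq
  have hqj : ∀ m : Fin 2 →₀ ℕ, m j ≠ 0 → MvPowerSeries.coeff m q = 0 := by
    intro m hm
    have h1 := congrArg (MvPowerSeries.coeff m) hq
    rw [euler, coeff_diag, map_zero, weight_fin_two p H.ne, hi, hj, mul_zero, zero_add,
      mul_one] at h1
    exact (mul_eq_zero.1 h1).resolve_left (Nat.cast_ne_zero.2 hm)
  have hu0 : u ≠ 0 := by
    rintro rfl; exact H.constantCoeff_ne_zero (map_zero _)
  -- As `∂_j q = 0`, the Hamiltonian derivative is `X i * u * ∂_i q`, to be compared with `h = X i *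
  -- X j * u`.
  have h1 : MvPowerSeries.pderiv ℂ i q = MvPowerSeries.X j ^ 1 * (ε • g) := by
    have h2 := hε q
    rw [hg, ham_apply, pderiv_eq_zero hqj, H.jac_snd, H.eq, mul_zero, sub_zero] at h2
    apply mul_left_cancel₀ (mul_ne_zero (X_ne_zero i) hu0)
    rw [h2, MvPowerSeries.smul_eq_C_mul, MvPowerSeries.smul_eq_C_mul]
    ring
  refine ⟨MvPowerSeries.constantCoeff q, ?_⟩
  ext m
  rw [MvPowerSeries.coeff_C]
  split_ifs with hm
  · rw [hm]; rfl
  by_cases hmj : m j = 0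
  · have hmi : 1 ≤ m i := by
      by_contra h0
      refine hm (Finsupp.ext fun k => ?_)
      rcases H.fin_eq with ⟨rfl, rfl⟩ | ⟨rfl, rfl⟩ <;> fin_cases k <;> simp <;> omega
    obtain ⟨k, rfl⟩ := exists_eq_add_single hmi
    have hkj : k j = 0 := by
      rw [Finsupp.add_apply] at hmj; omega
    have h2 := congrArg (MvPowerSeries.coeff k) h1
    rw [coeff_X_pow_mul_of_lt j _ (by omega), MvPowerSeries.coeff_pderiv] at h2
    exact (mul_eq_zero.1 h2).resolve_right (Nat.cast_add_one_ne_zero _)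
  · exact hqj m hmj

end IsNode

end Singularity

/-! ### Bounded operators on a fixed polydisc -/

section Bounded

variable {σ : Type*}

/-- The map `T` is bounded for the norm of radius `r`. -/
def IsBoundedAt (r : ℝ≥0) (T : MvPowerSeries σ ℂ → MvPowerSeries σ ℂ) : Prop :=
  ∃ C : ℝ≥0, ∀ g, wnorm r (T g) ≤ C * wnorm r g

namespace IsBoundedAt

variable {r : ℝ≥0} {T U : MvPowerSeries σ ℂ → MvPowerSeries σ ℂ}

theorem id : IsBoundedAt r (fun g : MvPowerSeries σ ℂ => g) := ⟨1, fun g => by simp⟩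

theorem of_le (hT : IsBoundedAt r T) (C : ℝ≥0∞) (hC : C ≠ ∞)
    (hU : ∀ g, wnorm r (U g) ≤ C * wnorm r (T g)) : IsBoundedAt r U := by
  obtain ⟨D, hD⟩ := hT
  lift C to ℝ≥0 using hC
  refine ⟨C * D, fun g => (hU g).trans ?_⟩
  rw [ENNReal.coe_mul, mul_assoc]
  gcongr
  exact hD g

theorem add (hT : IsBoundedAt r T) (hU : IsBoundedAt r U) : IsBoundedAt r fun g => T g + U g := by
  obtain ⟨C, hC⟩ := hT
  obtain ⟨D, hD⟩ := hU
  refine ⟨C + D, fun g => (wnorm_add_le r _ _).trans ?_⟩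
  rw [ENNReal.coe_add, add_mul]
  exact add_le_add (hC g) (hD g)

theorem sub (hT : IsBoundedAt r T) (hU : IsBoundedAt r U) : IsBoundedAt r fun g => T g - U g := by
  obtain ⟨C, hC⟩ := hT
  obtain ⟨D, hD⟩ := hU
  refine ⟨C + D, fun g => (wnorm_sub_le r _ _).trans ?_⟩
  rw [ENNReal.coe_add, add_mul]
  exact add_le_add (hC g) (hD g)

theorem mul_left (hT : IsBoundedAt r T) {a : MvPowerSeries σ ℂ} (ha : wnorm r a ≠ ∞) :
    IsBoundedAt r fun g => a * T g :=
  hT.of_le _ ha fun _ => wnorm_mul_le r _ _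

theorem smul (hT : IsBoundedAt r T) (c : ℂ) : IsBoundedAt r fun g => c • T g :=
  hT.of_le ‖c‖ₑ (by simp) fun _ => (wnorm_smul r c _).le

theorem shift (hT : IsBoundedAt r T) (hr : 0 < r) (i : σ) (n : ℕ) :
    IsBoundedAt r fun g => shift i n (T g) :=
  hT.of_le _ (by simpa using fun h => absurd h hr.ne') fun _ => wnorm_shift_le hr i n _

theorem diag (hT : IsBoundedAt r T) {w : (σ →₀ ℕ) → ℂ} {C : ℝ≥0} (hw : ∀ m, ‖w m‖₊ ≤ C) :
    IsBoundedAt r fun g => diag w (T g) :=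
  hT.of_le C (by simp) fun _ => wnorm_diag_le r hw _

theorem freeOf (hT : IsBoundedAt r T) (i : σ) : IsBoundedAt r fun g => freeOf i (T g) :=
  hT.of_le 1 (by simp) fun _ => by rw [one_mul]; exact wnorm_freeOf_le r i _

end IsBoundedAt

theorem IsConvergent.exists_radius {f : MvPowerSeries σ ℂ} (hf : IsConvergent f) :
    ∃ r₀ : ℝ≥0, 0 < r₀ ∧ ∀ r ≤ r₀, wnorm r f ≠ ∞ := by
  obtain ⟨r, hr, hf⟩ := isConvergent_iff_wnorm.1 hf
  exact ⟨r, hr, fun s hs => ne_top_of_le_ne_top hf (wnorm_mono hs f)⟩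

theorem wnorm_X_ne_top (r : ℝ≥0) (i : σ) : wnorm r (MvPowerSeries.X i : MvPowerSeries σ ℂ) ≠ ∞ := by
  rw [MvPowerSeries.X, wnorm_monomial]
  exact ENNReal.mul_ne_top (by simp) (ENNReal.pow_ne_top ENNReal.coe_ne_top)

/-- A one-variable series is its own substitution at `X`, so the estimate for `powSum` applies. -/
theorem isConvergent_mk {c : ℕ → ℂ} {D : ℝ≥0∞} (hD : D ≠ ∞) (C : ℝ≥0)
    (hc : ∀ k, ‖c k‖ₑ ≤ D * (C : ℝ≥0∞) ^ k) : IsConvergent (PowerSeries.mk c) := by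
  have hX : MvPowerSeries.constantCoeff (PowerSeries.X : PowerSeries ℂ) = 0 :=
    PowerSeries.constantCoeff_X
  have h1 : PowerSeries.mk c =
      powSum (PowerSeries.X : PowerSeries ℂ) fun k => MvPowerSeries.C (c k) := by
    have := subst_eq_powSum hX (PowerSeries.mk c)
    simp only [PowerSeries.coeff_mk] at this
    rw [← this]
    ext n
    rw [PowerSeries.coeff_subst' (PowerSeries.HasSubst.X' (R := ℂ)), finsum_eq_single _ n]
    · simp
    · intro k hk
      rw [PowerSeries.coeff_X_pow, if_neg hk.symm, smul_zero]
  rw [h1]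
  refine isConvergent_powSum hX (IsConvergent.X ()) one_pos hD C fun k => ?_
  rw [← MvPowerSeries.monomial_zero_eq_C_apply, wnorm_monomial, map_zero, pow_zero, mul_one]
  exact hc k

end Bounded

/-! ### Iterating a bounded reduction modulo the image -/

section Reduction

variable {p : Fin 2 → ℕ} {δ : ℕ} {h : MvPolynomial (Fin 2) ℂ}

/-- Bounded operators which reduce every series, modulo the image of the Hamiltonian derivation,
to a combination of finitely many monomials and a multiple of `h`. -/
structure Reduction (h : MvPolynomial (Fin 2) ℂ) {ι : Type} [Fintype ι] (e : ι → Fin 2 →₀ ℕ)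
    (S W : FormalO2 → FormalO2) : Prop where
  eq : ∀ g, g = ∑ i, MvPowerSeries.monomial (e i) (MvPowerSeries.coeff (e i) g) + h * S g +
    ham h 0 1 (W g)
  bounded : ∃ r₀ : ℝ≥0, 0 < r₀ ∧ ∀ r, 0 < r → r ≤ r₀ → IsBoundedAt r S ∧ IsBoundedAt r W

/-- The monomials of the reduction generate the cokernel. -/
theorem Reduction.exists_eq {ι : Type} [Fintype ι] {e : ι → Fin 2 →₀ ℕ}
    {S W : FormalO2 → FormalO2} (R : Reduction h e S W)
    (h0 : MvPolynomial.constantCoeff h = 0) (g : FormalO2) :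
    ∃ (l : ι → PowerSeries ℂ) (w : FormalO2),
      g = ∑ i, (l i).subst (h : FormalO2) * MvPowerSeries.monomial (e i) 1 + ham h 0 1 w ∧
      (IsConvergent g → (∀ i, IsConvergent (l i)) ∧ IsConvergent w) := by
  have hu : MvPowerSeries.constantCoeff (h : FormalO2) = 0 := by
    rw [← MvPowerSeries.coeff_zero_eq_constantCoeff_apply, MvPolynomial.coeff_coe]; exact h0
  have hsucc : ∀ k, S^[k + 1] g = S (S^[k] g) := fun k => Function.iterate_succ_apply' S k g
  refine ⟨fun i => PowerSeries.mk fun k => MvPowerSeries.coeff (e i) (S^[k] g),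
    powSum h fun k => W (S^[k] g), ?_, fun hg => ?_⟩
  -- `Q n` is the expansion proposed for `S^[n] g`. Its error is `h` times the error at stage `n +
  -- 1`, so the error at stage `0` is divisible by every power of `h`.
  · set Q : ℕ → FormalO2 := fun n => ∑ i, powSum (h : FormalO2)
        (fun k => MvPowerSeries.C (MvPowerSeries.coeff (e i) (S^[n + k] g))) *
          MvPowerSeries.monomial (e i) 1 +
        ham h 0 1 (powSum (h : FormalO2) fun k => W (S^[n + k] g)) with hQ
    have hrec : ∀ n, S^[n] g - Q n = h * (S^[n + 1] g - Q (n + 1)) := by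
      intro n
      have h1 : ∀ {α : Type} (F : ℕ → α), (fun k => F (n + (k + 1))) = fun k => F (n + 1 + k) := by
        intro α F; funext k; congr 1; omega
      have h2 : Q n = ∑ i, MvPowerSeries.monomial (e i) (MvPowerSeries.coeff (e i) (S^[n] g)) +
          ham h 0 1 (W (S^[n] g)) + h * Q (n + 1) := by
        simp only [hQ]
        rw [powSum_eq hu (fun k => W (S^[n + k] g)), map_add, ham_coe_mul,
          h1 fun k => W (S^[k] g), add_zero, mul_add, Finset.mul_sum]
        have h3 : ∀ i, powSum (h : FormalO2)
            (fun k => MvPowerSeries.C (MvPowerSeries.coeff (e i) (S^[n + k] g))) *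
              MvPowerSeries.monomial (e i) 1 =
            MvPowerSeries.monomial (e i) (MvPowerSeries.coeff (e i) (S^[n] g)) +
            (h : FormalO2) * (powSum (h : FormalO2)
              (fun k => MvPowerSeries.C (MvPowerSeries.coeff (e i) (S^[n + 1 + k] g))) *
                MvPowerSeries.monomial (e i) 1) := by
          intro i
          rw [powSum_eq hu (fun k => MvPowerSeries.C (MvPowerSeries.coeff (e i) (S^[n + k] g))),
            h1 fun k => MvPowerSeries.C (MvPowerSeries.coeff (e i) (S^[k] g)), add_zero, add_mul,
            ← MvPowerSeries.monomial_zero_eq_C_apply, MvPowerSeries.monomial_mul_monomial,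
            zero_add, mul_one, mul_assoc]
        rw [Finset.sum_congr rfl fun i _ => h3 i, Finset.sum_add_distrib]
        ring
      have h4 := R.eq (S^[n] g)
      rw [h2, hsucc]
      linear_combination h4
    have hiter : ∀ n, g - Q 0 = (h : FormalO2) ^ n * (S^[n] g - Q n) := by
      intro n
      induction n with
      | zero => simp
      | succ n ih => rw [ih, hrec n, pow_succ]; ring
    have hfin : g = Q 0 := eq_of_forall_pow_dvd_sub hu fun n => ⟨_, hiter n⟩
    simp only [hQ, zero_add] at hfin
    simpa only [subst_eq_powSum hu, PowerSeries.coeff_mk] using hfin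
  · obtain ⟨r₁, hr₁, hR⟩ := R.bounded
    obtain ⟨r₂, hr₂, hg⟩ := hg.exists_radius
    obtain ⟨r, hr, hrr₁, hrr₂⟩ : ∃ r, 0 < r ∧ r ≤ r₁ ∧ r ≤ r₂ :=
      ⟨min r₁ r₂, lt_min hr₁ hr₂, min_le_left _ _, min_le_right _ _⟩
    -- The radius is fixed for all iterates, so `S^[k] g` grows at most like `C ^ k`, as
    -- `isConvergent_powSum` requires.
    obtain ⟨⟨C, hC⟩, ⟨D, hD⟩⟩ := hR r hr hrr₁
    have hg := hg r hrr₂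
    have hS : ∀ k, wnorm r (S^[k] g) ≤ wnorm r g * (C : ℝ≥0∞) ^ k := by
      intro k
      induction k with
      | zero => simp
      | succ k ih =>
        rw [hsucc, pow_succ]
        calc _ ≤ (C : ℝ≥0∞) * wnorm r (S^[k] g) := hC _
          _ ≤ (C : ℝ≥0∞) * (wnorm r g * (C : ℝ≥0∞) ^ k) := by gcongr
          _ = _ := by ring
    refine ⟨fun i => ?_, ?_⟩
    · have hr0 : (r : ℝ≥0∞) ^ (e i).degree ≠ 0 := by simpa using fun h => absurd h hr.ne'
      have hrt : (r : ℝ≥0∞) ^ (e i).degree ≠ ∞ := ENNReal.pow_ne_top ENNReal.coe_ne_top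
      refine isConvergent_mk (D := ((r : ℝ≥0∞) ^ (e i).degree)⁻¹ * wnorm r g)
        (ENNReal.mul_ne_top (ENNReal.inv_ne_top.2 hr0) hg) C fun k => ?_
      calc ‖MvPowerSeries.coeff (e i) (S^[k] g)‖ₑ
          = ((r : ℝ≥0∞) ^ (e i).degree)⁻¹ *
            (‖MvPowerSeries.coeff (e i) (S^[k] g)‖ₑ * (r : ℝ≥0∞) ^ (e i).degree) := by
            rw [mul_left_comm, ENNReal.inv_mul_cancel hr0 hrt, mul_one]
        _ ≤ ((r : ℝ≥0∞) ^ (e i).degree)⁻¹ * (wnorm r g * (C : ℝ≥0∞) ^ k) :=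
            mul_le_mul' le_rfl ((enorm_coeff_mul_le_wnorm r _ _).trans (hS k))
        _ = _ := by ring
    · refine isConvergent_powSum hu (.coe h) hr (D := D * wnorm r g)
        (ENNReal.mul_ne_top ENNReal.coe_ne_top hg) C fun k => ?_
      calc _ ≤ (D : ℝ≥0∞) * wnorm r (S^[k] g) := hD _
        _ ≤ (D : ℝ≥0∞) * (wnorm r g * (C : ℝ≥0∞) ^ k) := by gcongr; exact hS k
        _ = _ := by ring

/-- One step of the reduction, with convergence. -/
theorem Reduction.isConvergent {ι : Type} [Fintype ι] {e : ι → Fin 2 →₀ ℕ}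
    {S W : FormalO2 → FormalO2} (R : Reduction h e S W) {g : FormalO2} (hg : IsConvergent g) :
    IsConvergent (S g) ∧ IsConvergent (W g) := by
  obtain ⟨r₁, hr₁, hR⟩ := R.bounded
  obtain ⟨r₂, hr₂, hg⟩ := hg.exists_radius
  have hr : 0 < min r₁ r₂ := lt_min hr₁ hr₂
  obtain ⟨⟨C, hC⟩, ⟨D, hD⟩⟩ := hR _ hr (min_le_left _ _)
  have hg := hg _ (min_le_right r₁ r₂)
  exact ⟨isConvergent_iff_wnorm.2 ⟨_, hr, ne_top_of_le_ne_top
      (ENNReal.mul_ne_top ENNReal.coe_ne_top hg) (hC g)⟩,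
    isConvergent_iff_wnorm.2 ⟨_, hr, ne_top_of_le_ne_top
      (ENNReal.mul_ne_top ENNReal.coe_ne_top hg) (hD g)⟩⟩

end Reduction

/-! ### Construction of the reductions -/

section Reductions

variable {p : Fin 2 → ℕ} {δ : ℕ} {h : MvPolynomial (Fin 2) ℂ}

/-- The part of `f` divisible by `X 0 ^ N`, divided by it. -/
def highFst (N : ℕ) (f : FormalO2) : FormalO2 :=
  shift 0 N f

/-- The part of `f` divisible by `X 1 ^ N` but of degree less than `N` in `X 0`, divided by
`X 1 ^ N`. -/
def highSnd (N : ℕ) (f : FormalO2) : FormalO2 :=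
  shift 1 N (diag (fun m => if m 0 < N then 1 else 0) f)

/-- The exponent `(a, b)`. -/
def boxExp {N : ℕ} (k : Fin N × Fin N) : Fin 2 →₀ ℕ :=
  Finsupp.single 0 (k.1 : ℕ) + Finsupp.single 1 (k.2 : ℕ)

/-- Exponents split disjointly into the box, those with `m 0 ≥ N`, and those with `m 0 < N ≤ m 1`;
this is why `highSnd` first cuts off the large powers of `X 0`. -/
theorem eq_box_add_high (N : ℕ) (f : FormalO2) :
    f = ∑ k : Fin N × Fin N, MvPowerSeries.monomial (boxExp k) (MvPowerSeries.coeff (boxExp k) f) +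
      (MvPowerSeries.X 0 ^ N * highFst N f + MvPowerSeries.X 1 ^ N * highSnd N f) := by
  classical
  have hsum : ∀ m : Fin 2 →₀ ℕ, MvPowerSeries.coeff m (∑ k : Fin N × Fin N,
      MvPowerSeries.monomial (boxExp k) (MvPowerSeries.coeff (boxExp k) f)) =
      if m 0 < N ∧ m 1 < N then MvPowerSeries.coeff m f else 0 := by
    intro m
    rw [map_sum]
    simp only [MvPowerSeries.coeff_monomial]
    split_ifs with hm
    · have hbox : boxExp ((⟨m 0, hm.1⟩, ⟨m 1, hm.2⟩) : Fin N × Fin N) = m := by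
        ext i; fin_cases i <;> simp [boxExp]
      rw [Finset.sum_eq_single ((⟨m 0, hm.1⟩, ⟨m 1, hm.2⟩) : Fin N × Fin N)]
      · rw [hbox, if_pos rfl]
      · intro k _ hk
        refine if_neg fun hmk => hk ?_
        subst hmk
        ext <;> simp [boxExp]
      · simp
    · refine Finset.sum_eq_zero fun k _ => if_neg fun hmk => hm ?_
      subst hmk
      simp [boxExp]
  ext m
  rw [map_add, map_add, hsum]
  rcases lt_or_ge (m 0) N with h0 | h0
  · rw [coeff_X_pow_mul_of_lt 0 _ h0, zero_add]
    rcases lt_or_ge (m 1) N with h1 | h1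
    · rw [coeff_X_pow_mul_of_lt 1 _ h1, if_pos ⟨h0, h1⟩, add_zero]
    · obtain ⟨k, rfl⟩ := exists_eq_add_single h1
      rw [coeff_X_pow_mul_add, if_neg (by omega), zero_add, highSnd, coeff_shift, coeff_diag,
        if_pos h0, one_mul]
  · rw [if_neg (by omega), zero_add]
    obtain ⟨k, rfl⟩ := exists_eq_add_single h0
    rw [coeff_X_pow_mul_add, highFst, coeff_shift]
    rcases lt_or_ge ((k + Finsupp.single 0 N : Fin 2 →₀ ℕ) 1) N with h1 | h1
    · rw [coeff_X_pow_mul_of_lt 1 _ h1, add_zero]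
    · obtain ⟨l, hl⟩ := exists_eq_add_single h1
      rw [hl, coeff_X_pow_mul_add, highSnd, coeff_shift, coeff_diag, ← hl, if_neg (by omega),
        zero_mul, add_zero]

theorem IsConvergent.highFst {f : FormalO2} (hf : IsConvergent f) (N : ℕ) :
    IsConvergent (highFst N f) := hf.shift 0 N

theorem IsConvergent.highSnd {f : FormalO2} (hf : IsConvergent f) (N : ℕ) :
    IsConvergent (highSnd N f) :=
  (hf.diag (C := 1) fun m => by split_ifs <;> simp).shift 1 N

theorem IsBoundedAt.highFst {r : ℝ≥0} (hr : 0 < r) (N : ℕ) : IsBoundedAt r (highFst N) :=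
  IsBoundedAt.id.shift hr 0 N

theorem IsBoundedAt.highSnd {r : ℝ≥0} (hr : 0 < r) (N : ℕ) : IsBoundedAt r (highSnd N) :=
  (IsBoundedAt.id.diag (C := 1) fun m => by split_ifs <;> simp).shift hr 1 N

/-- Differentiation is not bounded at a fixed radius. After a diagonal operator it is, provided the
factors `w m` absorb `m i`. -/
theorem pderiv_diag (i : Fin 2) (w : (Fin 2 →₀ ℕ) → ℂ) (f : FormalO2) :
    MvPowerSeries.pderiv ℂ i (diag w f) = shift i 1 (diag (fun m => (m i : ℂ) * w m) f) := by
  ext m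
  rw [MvPowerSeries.coeff_pderiv, coeff_shift, coeff_diag, coeff_diag]
  simp
  ring

/-- If `A` is divided in weighted degree `d` by `d + p j`, the image of `A` under
multiplication by `h_i` is a multiple of `h` modulo the image of the Hamiltonian derivation. -/
theorem jac_mul_eq (hh : MvPolynomial.IsWeightedHomogeneous p h δ) {i j : Fin 2} (hij : i ≠ j)
    (hj : p j ≠ 0) (A : FormalO2) :
    jac h i * A = (h : FormalO2) * ((δ : FormalO2) *
        MvPowerSeries.pderiv ℂ i (diag (fun m => ((Finsupp.weight p m + p j : ℕ) : ℂ)⁻¹) A)) -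
      ham h i j ((p j : FormalO2) * (MvPowerSeries.X j *
        diag (fun m => ((Finsupp.weight p m + p j : ℕ) : ℂ)⁻¹) A)) := by
  -- With `(E + p j) A' = A`, the terms in `∂_i A'` combine through Euler's identity into a multiple
  -- of `h`, and what remains is `h_i (E + p j) A'`.
  have hinv := euler_add_natCast_mul p A (n := p j) (fun m => by omega)
  set A' := diag (fun m => ((Finsupp.weight p m + p j : ℕ) : ℂ)⁻¹) A
  have hE := euler_jac hh hij
  have hcast : ∀ k : Fin 2, MvPowerSeries.pderiv ℂ k (p j : FormalO2) = 0 := fun k =>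
    Derivation.map_natCast _ _
  rw [euler_eq p hij] at hinv
  rw [ham_apply]
  simp only [Derivation.leibniz, hcast, MvPowerSeries.pderiv_X_self,
    MvPowerSeries.pderiv_X_of_ne hij.symm, smul_eq_mul]
  linear_combination (MvPowerSeries.pderiv ℂ i A') * hE - jac h i * hinv

theorem nnnorm_natCast_mul_inv_le_one {a b : ℕ} (hab : a ≤ b) :
    ‖(a : ℂ) * ((b : ℕ) : ℂ)⁻¹‖₊ ≤ 1 := by
  rw [nnnorm_mul, nnnorm_inv, RCLike.nnnorm_natCast, RCLike.nnnorm_natCast, ← div_eq_mul_inv]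
  exact div_le_one_of_le₀ (by exact_mod_cast hab) (by positivity)

/-- Outside the box, `g` is written in the Jacobian ideal through the fixed expressions of `X i ^
N`, and `jac_mul_eq` turns each generator into a multiple of `h` plus an image. Every operation is
linear and bounded. -/
theorem exists_reduction_of_weights_ne_zero (hp : ∀ i, p i ≠ 0)
    (hh : MvPolynomial.IsWeightedHomogeneous p h δ) {N : ℕ} (hN : JacobianPrimary h N) :
    ∃ S W, Reduction h (boxExp (N := N)) S W := by
  obtain ⟨A₀, B₀, hA₀, hB₀, h₀⟩ := hN 0
  obtain ⟨A₁, B₁, hA₁, hB₁, h₁⟩ := hN 1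
  set A : FormalO2 → FormalO2 := fun g => A₀ * highFst N g + A₁ * highSnd N g with hA
  set B : FormalO2 → FormalO2 := fun g => B₀ * highFst N g + B₁ * highSnd N g with hB
  set D : Fin 2 → FormalO2 → FormalO2 := fun j =>
    diag (fun m => ((Finsupp.weight p m + p j : ℕ) : ℂ)⁻¹) with hD
  have h01 : (0 : Fin 2) ≠ 1 := by decide
  refine ⟨fun g => (δ : FormalO2) * MvPowerSeries.pderiv ℂ 0 (D 1 (A g)) +
      (δ : FormalO2) * MvPowerSeries.pderiv ℂ 1 (D 0 (B g)),
    fun g => (p 0 : FormalO2) * (MvPowerSeries.X 0 * D 0 (B g)) -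
      (p 1 : FormalO2) * (MvPowerSeries.X 1 * D 1 (A g)), fun g => ?_, ?_⟩
  · conv_lhs => rw [eq_box_add_high N g]
    rw [add_assoc]
    congr 1
    have e1 := jac_mul_eq hh h01 (hp 1) (A g)
    have e2 := jac_mul_eq hh h01.symm (hp 0) (B g)
    rw [ham_swap h 0 1] at e2
    rw [map_sub, h₀, h₁]
    linear_combination e1 + e2
  · obtain ⟨r1, hr1, hA₀⟩ := hA₀.exists_radius
    obtain ⟨r2, hr2, hA₁⟩ := hA₁.exists_radius
    obtain ⟨r3, hr3, hB₀⟩ := hB₀.exists_radius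
    obtain ⟨r4, hr4, hB₁⟩ := hB₁.exists_radius
    refine ⟨min (min r1 r2) (min r3 r4), lt_min (lt_min hr1 hr2) (lt_min hr3 hr4),
      fun r hr hle => ?_⟩
    obtain ⟨⟨l1, l2⟩, l3, l4⟩ := (by simpa only [le_min_iff] using hle :
      (r ≤ r1 ∧ r ≤ r2) ∧ r ≤ r3 ∧ r ≤ r4)
    have bA : IsBoundedAt r A := ((IsBoundedAt.highFst hr N).mul_left (hA₀ r l1)).add
      ((IsBoundedAt.highSnd hr N).mul_left (hA₁ r l2))
    have bB : IsBoundedAt r B := ((IsBoundedAt.highFst hr N).mul_left (hB₀ r l3)).add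
      ((IsBoundedAt.highSnd hr N).mul_left (hB₁ r l4))
    have hcast : ∀ n : ℕ, wnorm r (n : FormalO2) ≠ ∞ := fun n => by
      have hC : (n : FormalO2) = MvPowerSeries.monomial 0 (n : ℂ) := by simp
      rw [hC, wnorm_monomial]; simp
    -- All weights are at least `1`, so inverting `E + p j` gains the factor `m i` that a derivative
    -- loses.
    have hweight : ∀ i j (m : Fin 2 →₀ ℕ), m i ≤ Finsupp.weight p m + p j := by
      intro i j m
      have h1 : m 0 ≤ m 0 * p 0 := Nat.le_mul_of_pos_right _ (Nat.pos_of_ne_zero (hp 0))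
      have h2 : m 1 ≤ m 1 * p 1 := Nat.le_mul_of_pos_right _ (Nat.pos_of_ne_zero (hp 1))
      rw [weight_fin_two p h01]
      fin_cases i <;> simp only [Fin.zero_eta, Fin.mk_one] <;> omega
    have hderiv : ∀ i j {T : FormalO2 → FormalO2}, IsBoundedAt r T →
        IsBoundedAt r fun g => MvPowerSeries.pderiv ℂ i (D j (T g)) := by
      intro i j T hT
      simp only [hD, pderiv_diag]
      exact (hT.diag (C := 1) fun m => nnnorm_natCast_mul_inv_le_one (hweight i j m)).shift hr i 1
    have hdiag : ∀ j {T : FormalO2 → FormalO2}, IsBoundedAt r T →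
        IsBoundedAt r fun g => D j (T g) := fun j T hT =>
      hT.diag (C := 1) fun m => nnnorm_inv_natCast_le_one _
    exact ⟨((hderiv 0 1 bA).mul_left (hcast _)).add ((hderiv 1 0 bB).mul_left (hcast _)),
      (((hdiag 0 bB).mul_left (wnorm_X_ne_top r 0)).mul_left (hcast _)).sub
        (((hdiag 1 bA).mul_left (wnorm_X_ne_top r 1)).mul_left (hcast _))⟩

/-- A primitive of `f` with respect to the variable `i`. -/
def primitive (i : Fin 2) (f : FormalO2) : FormalO2 :=
  MvPowerSeries.X i * diag (fun m => ((m i + 1 : ℕ) : ℂ)⁻¹) f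

theorem pderiv_primitive (i : Fin 2) (f : FormalO2) :
    MvPowerSeries.pderiv ℂ i (primitive i f) = f := by
  ext m
  have := coeff_X_pow_mul_add i 1 (diag (fun m => ((m i + 1 : ℕ) : ℂ)⁻¹) f) m
  rw [pow_one] at this
  rw [MvPowerSeries.coeff_pderiv, primitive, this, coeff_diag]
  push_cast
  rw [mul_right_comm, inv_mul_cancel₀ (Nat.cast_add_one_ne_zero _), one_mul]

theorem coeff_eq_zero_of_pderiv_eq_zero {j : Fin 2} {f : FormalO2}
    (hf : MvPowerSeries.pderiv ℂ j f = 0) {m : Fin 2 →₀ ℕ} (hm : m j ≠ 0) :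
    MvPowerSeries.coeff m f = 0 := by
  obtain ⟨k, rfl⟩ := exists_eq_add_single (Nat.pos_of_ne_zero hm)
  have := congrArg (MvPowerSeries.coeff k) hf
  rw [MvPowerSeries.coeff_pderiv, map_zero] at this
  exact (mul_eq_zero.1 this).resolve_right (Nat.cast_add_one_ne_zero _)

theorem pderiv_diag_eq_zero {j : Fin 2} {f : FormalO2} (hf : MvPowerSeries.pderiv ℂ j f = 0)
    (w : (Fin 2 →₀ ℕ) → ℂ) : MvPowerSeries.pderiv ℂ j (diag w f) = 0 :=
  IsNode.pderiv_eq_zero fun m hm => by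
    rw [coeff_diag, coeff_eq_zero_of_pderiv_eq_zero hf hm, mul_zero]

theorem pderiv_freeOf (j : Fin 2) (f : FormalO2) :
    MvPowerSeries.pderiv ℂ j (freeOf j f) = 0 := by
  classical
  exact IsNode.pderiv_eq_zero fun m hm => by rw [coeff_freeOf, if_neg hm]

theorem add_X_mul_pderiv_diag (j : Fin 2) (f : FormalO2) :
    diag (fun m => ((m j + 1 : ℕ) : ℂ)⁻¹) f + MvPowerSeries.X j *
      MvPowerSeries.pderiv ℂ j (diag (fun m => ((m j + 1 : ℕ) : ℂ)⁻¹) f) = f := by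
  ext m
  rw [map_add, coeff_X_mul_pderiv, coeff_diag]
  have : ((m j + 1 : ℕ) : ℂ) ≠ 0 := Nat.cast_ne_zero.2 (by omega)
  field_simp
  push_cast; ring

/-- Write `g = g(0) + X i * g₁ + X j * k + X i * X j * g₂`, where `g₁` depends only on `X i` and `k`
only on `X j`. The last term is a multiple of `h` because `u` is a unit; the two middle terms are
integrated in one variable, modulo `h`. -/
theorem IsNode.exists_reduction {i j : Fin 2} {u : FormalO2} (H : IsNode h i j u) :
    ∃ S W, Reduction h (fun _ : Unit => 0) S W := by
  classical
  set v := u + MvPowerSeries.X i * MvPowerSeries.pderiv ℂ i u with hv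
  have hu0 := H.constantCoeff_ne_zero
  have hv0 : MvPowerSeries.constantCoeff v ≠ 0 := by
    rw [H.constantCoeff_derivUnit]; exact H.constantCoeff_ne_zero
  have huu : u * u⁻¹ = 1 := MvPowerSeries.mul_inv_cancel _ hu0
  have hvv : v * v⁻¹ = 1 := MvPowerSeries.mul_inv_cancel _ hv0
  have hdu : MvPowerSeries.pderiv ℂ j u⁻¹ = 0 := by
    rw [MvPowerSeries.pderiv_inv', pderiv_eq_zero H.coeff_eq_zero, mul_zero]
  have hdv : MvPowerSeries.pderiv ℂ j v⁻¹ = 0 := by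
    rw [MvPowerSeries.pderiv_inv', pderiv_eq_zero fun m hm => H.coeff_derivUnit_eq_zero hm,
      mul_zero]
  obtain ⟨ε, hε⟩ := H.exists_ham_eq
  set g₁ : FormalO2 → FormalO2 := fun g => freeOf j (shift i 1 g)
  set g₂ : FormalO2 → FormalO2 := fun g => shift j 1 (shift i 1 g)
  set k : FormalO2 → FormalO2 := fun g => shift j 1 (freeOf i g)
  -- Chosen so that `∂_j (X j * K g) = k g`.
  set K : FormalO2 → FormalO2 := fun g => diag (fun m => ((m j + 1 : ℕ) : ℂ)⁻¹) (k g) with hK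
  refine ⟨fun g => u⁻¹ * g₂ g + MvPowerSeries.pderiv ℂ i v⁻¹ * K g,
    fun g => ε • (primitive i (u⁻¹ * g₁ g) - MvPowerSeries.X j * (v⁻¹ * K g)), fun g => ?_, ?_⟩
  · have e1 := freeOf_add_X_mul_shift i g
    have e2 : freeOf j (shift i 1 g) + MvPowerSeries.X j * g₂ g = shift i 1 g :=
      freeOf_add_X_mul_shift j _
    have e3 : freeOf j (freeOf i g) + MvPowerSeries.X j * k g = freeOf i g :=
      freeOf_add_X_mul_shift j _
    have e4 : freeOf j (freeOf i g) = MvPowerSeries.monomial 0 (MvPowerSeries.coeff 0 g) := by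
      ext m
      rw [coeff_freeOf, coeff_freeOf, MvPowerSeries.coeff_monomial]
      by_cases hm : m = 0
      · simp [hm]
      · rw [if_neg hm]
        split_ifs with hj hi
        · refine absurd (Finsupp.ext fun l => ?_) hm
          rcases H.fin_eq with ⟨rfl, rfl⟩ | ⟨rfl, rfl⟩ <;> fin_cases l <;> simpa
        · rfl
        · rfl
    have d1 : ham h i j (primitive i (u⁻¹ * g₁ g)) = MvPowerSeries.X i * g₁ g := by
      have hz : MvPowerSeries.pderiv ℂ j (primitive i (u⁻¹ * g₁ g)) = 0 := by
        rw [primitive, Derivation.leibniz, MvPowerSeries.pderiv_X_of_ne H.ne,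
          pderiv_diag_eq_zero, smul_zero, smul_zero, add_zero]
        rw [Derivation.leibniz, pderiv_freeOf, hdu, smul_zero, smul_zero, add_zero]
      rw [ham_apply, pderiv_primitive, hz, H.jac_snd]
      linear_combination MvPowerSeries.X i * g₁ g * huu
    -- The derivative of `v⁻¹` along `X i` meets `h_j * X j = h`, which is the only source of a
    -- multiple of `h` here.
    have d2 : ham h i j (MvPowerSeries.X j * (v⁻¹ * K g)) =
        (h : FormalO2) * (MvPowerSeries.pderiv ℂ i v⁻¹ * K g) - MvPowerSeries.X j * k g := by
      have hKi : MvPowerSeries.pderiv ℂ i (K g) = 0 := by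
        refine pderiv_diag_eq_zero (pderiv_eq_zero fun m hm => ?_) _
        rw [coeff_shift, coeff_freeOf, if_neg (by simpa [H.ne] using hm)]
      have hKj := add_X_mul_pderiv_diag j (k g)
      rw [ham_apply, H.jac_fst, H.jac_snd, H.eq]
      simp only [Derivation.leibniz, hKi, hdv, MvPowerSeries.pderiv_X_self,
        MvPowerSeries.pderiv_X_of_ne H.ne.symm, smul_eq_mul]
      linear_combination (-MvPowerSeries.X j * v * v⁻¹) * hKj - MvPowerSeries.X j * k g * hvv
    have d3 : ∀ f, ham h 0 1 (ε • f) = ham h i j f := fun f => by rw [Derivation.map_smul, ← hε]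
    rw [d3, map_sub, d1, d2, Finset.univ_unique, Finset.sum_singleton, ← e4]
    conv_lhs => rw [← e1, ← e2, ← e3]
    rw [H.eq]
    linear_combination -MvPowerSeries.X i * MvPowerSeries.X j * g₂ g * huu
  · obtain ⟨r1, hr1, hu⟩ := (H.isConvergent.inv hu0).exists_radius
    obtain ⟨r2, hr2, hvr⟩ := (H.isConvergent_derivUnit.inv hv0).exists_radius
    obtain ⟨r3, hr3, hdvr⟩ := ((H.isConvergent_derivUnit.inv hv0).pderiv i).exists_radius
    refine ⟨min r1 (min r2 r3), lt_min hr1 (lt_min hr2 hr3), fun r hr hle => ?_⟩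
    obtain ⟨l1, l2, l3⟩ := (by simpa only [le_min_iff] using hle : r ≤ r1 ∧ r ≤ r2 ∧ r ≤ r3)
    have b0 : IsBoundedAt r fun g : FormalO2 => shift i 1 g := IsBoundedAt.id.shift hr i 1
    have b1 : IsBoundedAt r g₁ := b0.freeOf j
    have b2 : IsBoundedAt r g₂ := b0.shift hr j 1
    have bK : IsBoundedAt r K := ((IsBoundedAt.id.freeOf i).shift hr j 1).diag (C := 1)
      fun m => nnnorm_inv_natCast_le_one _
    exact ⟨(b2.mul_left (hu r l1)).add (bK.mul_left (hdvr r l3)),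
      ((((b1.mul_left (hu r l1)).diag (C := 1) fun m => nnnorm_inv_natCast_le_one _).mul_left
        (wnorm_X_ne_top r i)).sub ((bK.mul_left (hvr r l2)).mul_left (wnorm_X_ne_top r j))).smul ε⟩

end Reductions

/-! ### Cokernels of derivations: torsion-freeness and Nakayama -/

section Abstract

/-- If a derivation `D` vanishes on a subalgebra `S` which is local with maximal ideal `(η)`, the
cokernel of `D` is finitely generated and `η`-torsion free over `S`, and `J = η B + D B`, then
families whose classes form a basis of `B ⧸ J` form a basis of the cokernel. -/
theorem formsBasis_coker {B : Type*} [CommRing B] [Algebra ℂ B] (D : Derivation ℂ B B)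
    (S : Subalgebra ℂ B) (hS : ∀ s ∈ S, D s = 0) (η : S) (J : Ideal B)
    (hdecomp : ∀ s : S, ∃ (c : ℂ) (s' : S), s = algebraMap ℂ S c + η * s')
    (hunit : ∀ s : S, IsUnit (η * s + 1))
    (hsep : ∀ s : S, (∀ n : ℕ, η ^ n ∣ s) → s = 0)
    (htors : ∀ b w : B, (η : B) * b = D w → ∃ t, D t = b)
    (hD : ∀ w, D w ∈ J) (hη : (η : B) ∈ J)
    (hJ : ∀ b ∈ J, ∃ b' w, b = (η : B) * b' + D w)
    (hfg : ∃ (ι : Type) (_ : Fintype ι) (e : ι → B),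
      ∀ b, ∃ (l : ι → S) (w : B), b = ∑ i, (l i : B) * e i + D w)
    {n : ℕ} (a : Fin n → B) (ha : FormsBasis ℂ fun i => Ideal.Quotient.mk J (a i)) :
    FormsBasis S fun i =>
      (Submodule.Quotient.mk (a i) : B ⧸ LinearMap.range (linearOver D S hS)) := by
  have hmem : ∀ b : B, (Submodule.Quotient.mk b : B ⧸ LinearMap.range (linearOver D S hS)) = 0 ↔
      ∃ w, D w = b := fun b => by
    rw [Submodule.Quotient.mk_eq_zero]; exact Iff.rfl
  constructor
  · rw [Fintype.linearIndependent_iff]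
    intro s hs
    have hs' : ∃ w, D w = ∑ i, (s i : B) * a i := by
      rw [← hmem, ← hs, ← Submodule.mkQ_apply, map_sum]
      rfl
    -- A relation can be divided by `η` indefinitely: its constant terms vanish by independence
    -- modulo `J`, and torsion-freeness makes the quotient a relation again. Separatedness then
    -- kills the coefficients.
    have key : ∀ k : ℕ, ∃ s' : Fin n → S, (∀ i, s i = η ^ k * s' i) ∧
        ∃ w, D w = ∑ i, (s' i : B) * a i := by
      intro k
      induction k with
      | zero => exact ⟨s, fun i => by simp, hs'⟩
      | succ k ih =>
        obtain ⟨s', h1, w, hw⟩ := ih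
        choose c t ht using fun i => hdecomp (s' i)
        have h2 : ∀ i, (s' i : B) = algebraMap ℂ B (c i) + η * t i := fun i => by
          conv_lhs => rw [ht i]
          rfl
        have h3 : ∑ i, c i • Ideal.Quotient.mk J (a i) = 0 := by
          have h4 : ∑ i, c i • a i ∈ J := by
            have h5 : ∑ i, c i • a i = D w - ∑ i, ((t i : B) * a i) * η := by
              rw [hw, ← Finset.sum_sub_distrib]
              refine Finset.sum_congr rfl fun i _ => ?_
              rw [h2, Algebra.smul_def]; ring
            rw [h5]
            exact J.sub_mem (hD w) (J.sum_mem fun i _ => J.mul_mem_left _ hη)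
          rw [← Ideal.Quotient.eq_zero_iff_mem.2 h4, map_sum]
          rfl
        have hc := Fintype.linearIndependent_iff.1 ha.1 c h3
        refine ⟨t, fun i => ?_, ?_⟩
        · rw [h1, ht i, hc i, map_zero, zero_add]; ring
        · refine htors _ w ?_
          rw [hw, Finset.mul_sum]
          refine Finset.sum_congr rfl fun i _ => ?_
          rw [h2, hc i, map_zero, zero_add]; ring
    intro i
    refine hsep _ fun k => ?_
    obtain ⟨s', h1, -⟩ := key k
    exact ⟨s' i, h1 i⟩
  · set M := B ⧸ LinearMap.range (linearOver D S hS)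
    set N : Submodule S M := Submodule.span S (Set.range fun i => (Submodule.Quotient.mk (a i) : M))
    rw [eq_top_iff]
    -- Nakayama's lemma: the cokernel is finitely generated, `η` lies in the Jacobson radical, and
    -- the classes span modulo `η` since `J = η B + D B`.
    refine Submodule.le_of_le_smul_of_le_jacobson_bot (I := Ideal.span {η}) ?_ ?_ ?_
    · obtain ⟨ι, _, e, he⟩ := hfg
      have : (⊤ : Submodule S M) =
          Submodule.span S (Set.range fun i => (Submodule.Quotient.mk (e i) : M)) := by
        refine (eq_top_iff.2 fun x _ => ?_).symm
        obtain ⟨b, rfl⟩ := Submodule.Quotient.mk_surjective _ x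
        obtain ⟨l, w, hb⟩ := he b
        have h1 : (Submodule.Quotient.mk b : M) = ∑ i, l i • (Submodule.Quotient.mk (e i) : M) := by
          have h2 : (Submodule.Quotient.mk (D w) : M) = 0 := (hmem _).2 ⟨w, rfl⟩
          rw [hb, Submodule.Quotient.mk_add, h2, add_zero, ← Submodule.mkQ_apply, map_sum]
          rfl
        rw [h1]
        exact Submodule.sum_mem _ fun i _ =>
          Submodule.smul_mem _ _ (Submodule.subset_span ⟨i, rfl⟩)
      rw [this]
      exact Submodule.fg_span (Set.finite_range _)
    · rw [Ideal.span_singleton_le_iff_mem, Ideal.mem_jacobson_bot]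
      exact hunit
    · intro x _
      obtain ⟨b, rfl⟩ := Submodule.Quotient.mk_surjective _ x
      have h1 : Ideal.Quotient.mk J b ∈ Submodule.span ℂ
          (Set.range fun i => Ideal.Quotient.mk J (a i)) := by rw [ha.2]; trivial
      obtain ⟨c, hc⟩ := (Submodule.mem_span_range_iff_exists_fun ℂ).1 h1
      have h2 : b - ∑ i, c i • a i ∈ J := by
        rw [← Ideal.Quotient.eq_zero_iff_mem, map_sub, ← hc, map_sum]
        exact sub_self _
      obtain ⟨b', w, hb⟩ := hJ _ h2
      have h3 : (Submodule.Quotient.mk b : M) =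
          ∑ i, algebraMap ℂ S (c i) • (Submodule.Quotient.mk (a i) : M) +
            η • (Submodule.Quotient.mk b' : M) := by
        have h4 : (Submodule.Quotient.mk (D w) : M) = 0 := (hmem _).2 ⟨w, rfl⟩
        have h5 : b = ∑ i, algebraMap ℂ S (c i) • a i + η • b' + D w := by
          rw [sub_eq_iff_eq_add] at hb
          rw [hb]
          have : ∑ i, algebraMap ℂ S (c i) • a i = ∑ i, c i • a i :=
            Finset.sum_congr rfl fun i _ => algebraMap_smul S (c i) (a i)
          rw [this, Subalgebra.smul_def, smul_eq_mul]; ring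
        conv_lhs => rw [h5]
        rw [Submodule.Quotient.mk_add, h4, add_zero, Submodule.Quotient.mk_add,
          ← Submodule.mkQ_apply, map_sum]
        rfl
      rw [h3]
      refine Submodule.add_mem_sup (Submodule.sum_mem _ fun i _ =>
        Submodule.smul_mem _ _ (Submodule.subset_span ⟨i, rfl⟩)) ?_
      exact Submodule.smul_mem_smul (Ideal.mem_span_singleton_self η) trivial

/-- A basis can be extracted from a spanning family, starting with a given nonzero member. -/
theorem exists_formsBasis_comp {V : Type*} [AddCommGroup V] [Module ℂ V] [Module.Finite ℂ V]
    {ι : Type*} (v : ι → V) (hv : Submodule.span ℂ (Set.range v) = ⊤) {i₀ : ι} (h₀ : v i₀ ≠ 0) :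
    ∃ a : Fin (Module.finrank ℂ V) → ι, (∀ i, i.val = 0 → a i = i₀) ∧
      FormsBasis ℂ fun i => v (a i) := by
  classical
  obtain ⟨b, -, hb₀, hbs, hb⟩ := exists_linearIndepOn_extension (K := ℂ) (v := v) (s := {i₀})
    (t := Set.univ) (by simpa using h₀) (Set.subset_univ _)
  have hspan : ⊤ ≤ Submodule.span ℂ (Set.range fun x : b => v x) := by
    rw [← hv, Submodule.span_le, ← Set.image_univ]
    refine hbs.trans (le_of_eq ?_)
    rw [Set.image_eq_range]
  let basis := Module.Basis.mk hb hspan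
  have : Finite b := Module.Finite.finite_basis basis
  have hcard : Nat.card b = Module.finrank ℂ V := (Module.finrank_eq_nat_card_basis basis).symm
  let i₁ : b := ⟨i₀, hb₀ rfl⟩
  have : Nonempty b := ⟨i₁⟩
  have hpos : 0 < Module.finrank ℂ V := by rw [← hcard]; exact Nat.card_pos
  let e : b ≃ Fin (Module.finrank ℂ V) := Finite.equivFinOfCardEq hcard
  -- The swap moves the prescribed member to index `0`.
  let e' := e.trans (Equiv.swap (e i₁) ⟨0, hpos⟩)
  have he' : e' i₁ = ⟨0, hpos⟩ := by simp [e']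
  have hli : LinearIndependent ℂ fun i => v (e'.symm i) :=
    LinearIndependent.comp (v := fun x : b => v x) hb _ e'.symm.injective
  refine ⟨fun i => (e'.symm i).1, fun i hi => ?_, hli,
    hli.span_eq_top_of_card_eq_finrank' (Fintype.card_fin _)⟩
  have : i = e' i₁ := by rw [he']; exact Fin.ext hi
  rw [this]
  exact congrArg Subtype.val (e'.symm_apply_apply i₁)

end Abstract

/-! ### The Jacobian ideal modulo `h`, and the two cases together -/

section Data

variable {p : Fin 2 → ℕ} {δ : ℕ} {h : MvPolynomial (Fin 2) ℂ}

/-- The Jacobian ideal is contained in the sum of `(h)` and the image of the Hamiltonian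
derivation. -/
def JacobianReduces (h : MvPolynomial (Fin 2) ℂ) : Prop :=
  ∀ A B : FormalO2, ∃ b w, A * jac h 0 + B * jac h 1 = (h : FormalO2) * b + ham h 0 1 w ∧
    (IsConvergent A → IsConvergent B → IsConvergent b ∧ IsConvergent w)

theorem isConvergent_natCast (n : ℕ) : IsConvergent (n : FormalO2) :=
  (convergentSeries (Fin 2)).natCast_mem n

theorem jacobianReduces_of_weights_ne_zero (hp : ∀ i, p i ≠ 0)
    (hh : MvPolynomial.IsWeightedHomogeneous p h δ) : JacobianReduces h := by
  intro A B
  have h01 : (0 : Fin 2) ≠ 1 := by decide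
  have e1 := jac_mul_eq hh h01 (hp 1) A
  have e2 := jac_mul_eq hh h01.symm (hp 0) B
  rw [ham_swap h 0 1] at e2
  set A' := diag (fun m => ((Finsupp.weight p m + p 1 : ℕ) : ℂ)⁻¹) A
  set B' := diag (fun m => ((Finsupp.weight p m + p 0 : ℕ) : ℂ)⁻¹) B
  refine ⟨(δ : FormalO2) * MvPowerSeries.pderiv ℂ 0 A' + (δ : FormalO2) *
    MvPowerSeries.pderiv ℂ 1 B', (p 0 : FormalO2) * (MvPowerSeries.X 0 * B') -
      (p 1 : FormalO2) * (MvPowerSeries.X 1 * A'), ?_, fun hA hB => ?_⟩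
  · rw [map_sub]
    linear_combination e1 + e2
  · have hA' : IsConvergent A' := hA.diag fun m => nnnorm_inv_natCast_le_one _
    have hB' : IsConvergent B' := hB.diag fun m => nnnorm_inv_natCast_le_one _
    exact ⟨((isConvergent_natCast δ).mul (hA'.pderiv 0)).add
      ((isConvergent_natCast δ).mul (hB'.pderiv 1)),
      ((isConvergent_natCast _).mul ((IsConvergent.X 0).mul hB')).sub
      ((isConvergent_natCast _).mul ((IsConvergent.X 1).mul hA'))⟩

theorem constantCoeff_jac (hs : IsIsolatedSingularity h) (i : Fin 2) :
    MvPowerSeries.constantCoeff (jac h i) = 0 := by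
  have := hs.1 i
  rw [MvPolynomial.eval_zero] at this
  rw [← MvPowerSeries.coeff_zero_eq_constantCoeff_apply, jac, MvPolynomial.coeff_coe]
  exact this

/-- The only monomial of the reduction is `1`, and its coefficient vanishes on the Jacobian ideal.
This replaces the argument by `jac_mul_eq`, which needs nonzero weights. -/
theorem Reduction.jacobianReduces (hs : IsIsolatedSingularity h) {S W : FormalO2 → FormalO2}
    (R : Reduction h (fun _ : Unit => 0) S W) : JacobianReduces h := by
  intro A B
  refine ⟨S (A * jac h 0 + B * jac h 1), W (A * jac h 0 + B * jac h 1), ?_, fun hA hB =>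
    R.isConvergent ((hA.mul (isConvergent_jac h 0)).add (hB.mul (isConvergent_jac h 1)))⟩
  conv_lhs => rw [R.eq (A * jac h 0 + B * jac h 1)]
  have h0 : MvPowerSeries.coeff 0 (A * jac h 0 + B * jac h 1) = 0 := by
    rw [MvPowerSeries.coeff_zero_eq_constantCoeff_apply, map_add, map_mul, map_mul,
      constantCoeff_jac hs, constantCoeff_jac hs, mul_zero, mul_zero, add_zero]
  simp [h0]

/-- What the proof of the main theorem uses about a quasi-homogeneous isolated singularity. -/
structure SingularityData (p : Fin 2 → ℕ) (h : MvPolynomial (Fin 2) ℂ) (N : ℕ) {ι : Type}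
    [Fintype ι] (e : ι → Fin 2 →₀ ℕ) (S W : FormalO2 → FormalO2) : Prop where
  primary : JacobianPrimary h N
  eulerKernel : EulerKernelConst p h
  reduction : Reduction h e S W
  jacobianReduces : JacobianReduces h

theorem exists_singularityData (hp : Nat.Coprime (p 0) (p 1))
    (hh : MvPolynomial.IsWeightedHomogeneous p h δ) (hs : IsIsolatedSingularity h) :
    ∃ (N : ℕ) (ι : Type) (_ : Fintype ι) (e : ι → Fin 2 →₀ ℕ) (S W : FormalO2 → FormalO2),
      SingularityData p h N e S W := by
  have hδ := degree_ne_zero hp hh hs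
  by_cases hpos : ∀ i, p i ≠ 0
  · obtain ⟨N, hN⟩ := jacobianPrimary_of_weights_ne_zero hpos hh hs
    obtain ⟨S, W, R⟩ := exists_reduction_of_weights_ne_zero hpos hh hN
    exact ⟨N, _, _, _, S, W, hN, eulerKernelConst_of_weights_ne_zero hpos, R,
      jacobianReduces_of_weights_ne_zero hpos hh⟩
  · obtain ⟨i, j, hij, hi, hj⟩ : ∃ i j, i ≠ j ∧ p i = 0 ∧ p j = 1 := by
      push Not at hpos
      obtain ⟨i, hi⟩ := hpos
      have h1 : (0 : Fin 2) ≠ 1 := by decide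
      fin_cases i
      · exact ⟨0, 1, h1, hi, by simpa [show p 0 = 0 from hi] using hp⟩
      · exact ⟨1, 0, h1.symm, hi, by simpa [show p 1 = 0 from hi] using hp⟩
    obtain ⟨u, H⟩ := exists_isNode hij hi hj hδ hh hs
    obtain ⟨S, W, R⟩ := H.exists_reduction
    exact ⟨1, _, _, _, S, W, H.jacobianPrimary, H.eulerKernelConst hi hj, R, R.jacobianReduces hs⟩

end Data

/-! ### The local algebra, formal and convergent -/

section Milnor

variable {p : Fin 2 → ℕ} {δ : ℕ} {h : MvPolynomial (Fin 2) ℂ} {N : ℕ}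

theorem mem_formalJ0 {f : FormalO2} :
    f ∈ formalJ0 h ↔ ∃ A B, A * jac h 0 + B * jac h 1 = f := Ideal.mem_span_pair

theorem mem_J0 {f : O2} : f ∈ J0 h ↔
    ∃ A B, IsConvergent A ∧ IsConvergent B ∧ A * jac h 0 + B * jac h 1 = taylor f := by
  rw [J0, Ideal.mem_span_pair]
  constructor
  · rintro ⟨a, b, rfl⟩
    exact ⟨taylor a, taylor b, isConvergent_taylor a, isConvergent_taylor b, by
      rw [map_add, map_mul, map_mul]; rfl⟩
  · rintro ⟨A, B, hA, hB, hf⟩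
    refine ⟨germ A hA, germ B hB, taylor_injective ?_⟩
    rw [map_add, map_mul, map_mul, ← hf]; rfl

/-- The part of `f` of degree less than `N` in each variable. -/
def boxPart (N : ℕ) (f : FormalO2) : FormalO2 :=
  ∑ k : Fin N × Fin N, MvPowerSeries.monomial (boxExp k) (MvPowerSeries.coeff (boxExp k) f)

theorem isConvergent_monomial (m : Fin 2 →₀ ℕ) (c : ℂ) :
    IsConvergent (MvPowerSeries.monomial m c : FormalO2) := by
  rw [← MvPolynomial.coe_monomial]; exact .coe _

theorem isConvergent_boxPart (N : ℕ) (f : FormalO2) : IsConvergent (boxPart N f) :=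
  (convergentSeries (Fin 2)).sum_mem fun _ _ => isConvergent_monomial _ _

theorem eq_boxPart_add (N : ℕ) (f : FormalO2) : f = boxPart N f +
    (MvPowerSeries.X 0 ^ N * highFst N f + MvPowerSeries.X 1 ^ N * highSnd N f) :=
  eq_box_add_high N f

/-- The multipliers expressing `X i ^ N` in the Jacobian ideal are convergent, so membership of the
remainder costs no convergence. -/
theorem exists_high_eq (hN : JacobianPrimary h N) (f : FormalO2) :
    ∃ A B, f = boxPart N f + (A * jac h 0 + B * jac h 1) ∧
      (IsConvergent f → IsConvergent A ∧ IsConvergent B) := by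
  obtain ⟨A₀, B₀, hA₀, hB₀, h₀⟩ := hN 0
  obtain ⟨A₁, B₁, hA₁, hB₁, h₁⟩ := hN 1
  refine ⟨A₀ * highFst N f + A₁ * highSnd N f, B₀ * highFst N f + B₁ * highSnd N f, ?_, fun hf => ?_⟩
  · have := eq_boxPart_add N f
    rw [h₀, h₁] at this
    linear_combination this
  · exact ⟨(hA₀.mul (hf.highFst N)).add (hA₁.mul (hf.highSnd N)),
      (hB₀.mul (hf.highFst N)).add (hB₁.mul (hf.highSnd N))⟩

/-- Truncating formal coefficients `A` and `B` to the box changes the combination only by terms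
divisible by `X 0 ^ N` or `X 1 ^ N`. The difference is convergent with no box part, so
`exists_high_eq` gives it convergent coefficients. -/
theorem taylor_mem_formalJ0_iff (hN : JacobianPrimary h N) {f : O2} :
    taylor f ∈ formalJ0 h ↔ f ∈ J0 h := by
  rw [mem_formalJ0, mem_J0]
  refine ⟨?_, fun ⟨A, B, _, _, hf⟩ => ⟨A, B, hf⟩⟩
  rintro ⟨A, B, hf⟩
  set F := taylor f - (boxPart N A * jac h 0 + boxPart N B * jac h 1) with hF
  have hFc : IsConvergent F := (isConvergent_taylor f).sub
    (((isConvergent_boxPart N A).mul (isConvergent_jac h 0)).add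
      ((isConvergent_boxPart N B).mul (isConvergent_jac h 1)))
  obtain ⟨A', B', hAB, hc⟩ := exists_high_eq hN F
  have hbox : boxPart N F = 0 := by
    have hA := eq_boxPart_add N A
    have hB := eq_boxPart_add N B
    have h1 : F = MvPowerSeries.X 0 ^ N * (highFst N A * jac h 0 + highFst N B * jac h 1) +
        MvPowerSeries.X 1 ^ N * (highSnd N A * jac h 0 + highSnd N B * jac h 1) := by
      rw [hF, ← hf]
      linear_combination jac h 0 * hA + jac h 1 * hB
    refine Finset.sum_eq_zero fun k _ => ?_
    rw [h1, map_add, coeff_X_pow_mul_of_lt 0 _ (by simp [boxExp]),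
      coeff_X_pow_mul_of_lt 1 _ (by simp [boxExp]), add_zero, map_zero]
  rw [hbox, zero_add] at hAB
  refine ⟨boxPart N A + A', boxPart N B + B', (isConvergent_boxPart N A).add (hc hFc).1,
    (isConvergent_boxPart N B).add (hc hFc).2, ?_⟩
  linear_combination -hAB + hF

/-- The Taylor expansion induces an isomorphism of the local algebras. -/
def milnorEquiv (hN : JacobianPrimary h N) : (O2 ⧸ J0 h) ≃ₗ[ℂ] (FormalO2 ⧸ formalJ0 h) :=
  (AlgEquiv.ofBijective (Ideal.quotientMapₐ (formalJ0 h) taylor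
      fun _ hf => (taylor_mem_formalJ0_iff hN).2 hf) ⟨by
    rw [injective_iff_map_eq_zero]
    intro x hx
    obtain ⟨f, rfl⟩ := Ideal.Quotient.mk_surjective x
    change Ideal.Quotient.mk (formalJ0 h) (taylor f) = 0 at hx
    exact Ideal.Quotient.eq_zero_iff_mem.2
      ((taylor_mem_formalJ0_iff hN).1 (Ideal.Quotient.eq_zero_iff_mem.1 hx)), by
    intro x
    obtain ⟨f, rfl⟩ := Ideal.Quotient.mk_surjective x
    -- Surjectivity: the box part is a polynomial representing the same class.
    obtain ⟨A, B, hf, -⟩ := exists_high_eq hN f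
    refine ⟨Ideal.Quotient.mk _ (germ (boxPart N f) (isConvergent_boxPart N f)), ?_⟩
    change Ideal.Quotient.mk _ (boxPart N f) = _
    rw [Ideal.Quotient.eq, mem_formalJ0]
    exact ⟨-A, -B, by linear_combination hf⟩⟩).toLinearEquiv

theorem milnorEquiv_mk (hN : JacobianPrimary h N) (f : O2) :
    milnorEquiv hN (Ideal.Quotient.mk _ f) = Ideal.Quotient.mk _ (taylor f) := rfl

theorem taylor_polyGerm_monomial (m : Fin 2 →₀ ℕ) (c : ℂ) :
    taylor (polyGerm (MvPolynomial.monomial m c)) = MvPowerSeries.monomial m c := by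
  rw [polyGerm, taylor_germ, MvPolynomial.coe_monomial]

theorem span_boxExp (hN : JacobianPrimary h N) : Submodule.span ℂ (Set.range
    fun k : Fin N × Fin N =>
      Ideal.Quotient.mk (J0 h) (polyGerm (MvPolynomial.monomial (boxExp k) 1))) = ⊤ := by
  rw [eq_top_iff]
  intro x _
  obtain ⟨f, rfl⟩ := Ideal.Quotient.mk_surjective x
  rw [Submodule.mem_span_range_iff_exists_fun]
  refine ⟨fun k => MvPowerSeries.coeff (boxExp k) (taylor f), ?_⟩
  have h1 : ∑ k : Fin N × Fin N, MvPowerSeries.coeff (boxExp k) (taylor f) •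
      polyGerm (MvPolynomial.monomial (boxExp k) 1) - f ∈ J0 h := by
    rw [mem_J0]
    obtain ⟨A, B, hf, hc⟩ := exists_high_eq hN (taylor f)
    obtain ⟨hA, hB⟩ := hc (isConvergent_taylor f)
    have h2 : taylor (∑ k : Fin N × Fin N, MvPowerSeries.coeff (boxExp k) (taylor f) •
        polyGerm (MvPolynomial.monomial (boxExp k) 1)) = boxPart N (taylor f) := by
      rw [map_sum]
      refine Finset.sum_congr rfl fun k _ => ?_
      rw [map_smul, taylor_polyGerm_monomial, ← map_smul, smul_eq_mul, mul_one]
    refine ⟨-A, -B, (convergentSeries (Fin 2)).neg_mem hA, (convergentSeries (Fin 2)).neg_mem hB, ?_⟩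
    rw [map_sub, h2]
    linear_combination hf
  rw [← Ideal.Quotient.eq] at h1
  rw [← h1, map_sum]
  rfl

theorem finite_quotient_J0 (hN : JacobianPrimary h N) : Module.Finite ℂ (O2 ⧸ J0 h) :=
  ⟨by rw [← span_boxExp hN]; exact Submodule.fg_span (Set.finite_range _)⟩

theorem one_notMem_J0 (hs : IsIsolatedSingularity h) : (1 : O2) ∉ J0 h := by
  rw [mem_J0]
  rintro ⟨A, B, -, -, hAB⟩
  have := congrArg MvPowerSeries.constantCoeff hAB
  simp [constantCoeff_jac hs] at this

theorem polyGerm_monomial_zero : polyGerm (MvPolynomial.monomial 0 1) = 1 :=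
  taylor_injective (by
    rw [taylor_polyGerm_monomial, MvPowerSeries.monomial_zero_one]
    exact (map_one taylor).symm)

theorem milnor_pos (hs : IsIsolatedSingularity h) (hN : JacobianPrimary h N) : 0 < milnor h := by
  have := finite_quotient_J0 hN
  have : Nontrivial (O2 ⧸ J0 h) :=
    Ideal.Quotient.nontrivial_iff.2 fun ht => one_notMem_J0 hs (by rw [ht]; trivial)
  exact Module.finrank_pos

theorem exists_monomial_basis (hs : IsIsolatedSingularity h) (hN : JacobianPrimary h N) :
    ∃ a : Fin (milnor h) → (Fin 2 →₀ ℕ), (∀ i, i.val = 0 → a i = 0) ∧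
      FormsBasis ℂ fun i =>
        Ideal.Quotient.mk (J0 h) (polyGerm (MvPolynomial.monomial (a i) 1)) := by
  have := finite_quotient_J0 hN
  refine exists_formsBasis_comp (fun m : Fin 2 →₀ ℕ =>
    Ideal.Quotient.mk (J0 h) (polyGerm (MvPolynomial.monomial m 1))) ?_ ?_
  · rw [eq_top_iff, ← span_boxExp hN]
    exact Submodule.span_mono (Set.range_subset_iff.2 fun k => ⟨boxExp k, rfl⟩)
  · rw [polyGerm_monomial_zero]
    exact fun h0 => one_notMem_J0 hs (Ideal.Quotient.eq_zero_iff_mem.1 h0)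

theorem FormsBasis.map {V V' ι : Type*} [AddCommGroup V] [AddCommGroup V'] [Module ℂ V]
    [Module ℂ V'] {v : ι → V} (hv : FormsBasis ℂ v) (e : V ≃ₗ[ℂ] V') :
    FormsBasis ℂ fun i => e (v i) := by
  refine ⟨hv.1.map' e.toLinearMap e.ker, ?_⟩
  have : (Set.range fun i => e (v i)) = e.toLinearMap '' Set.range v := by
    rw [← Set.range_comp]; rfl
  rw [this, Submodule.span_image, hv.2, Submodule.map_top, LinearEquiv.range]

end Milnor

/-! ### The cokernels over series in `h` -/

section Main

variable {p : Fin 2 → ℕ} {δ : ℕ} {h : MvPolynomial (Fin 2) ℂ} {N : ℕ} {ι : Type} [Fintype ι]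
  {e : ι → Fin 2 →₀ ℕ} {S W : FormalO2 → FormalO2}

theorem constantCoeff_coe (h0 : MvPolynomial.constantCoeff h = 0) :
    MvPowerSeries.constantCoeff (h : FormalO2) = 0 := by
  rw [← MvPowerSeries.coeff_zero_eq_constantCoeff_apply, MvPolynomial.coeff_coe]; exact h0

theorem formalX0_smul_eq_ham (hδ : δ ≠ 0) (w : FormalO2) :
    formalX0 δ h ((δ : ℂ) • w) = ham h 0 1 w := by
  rw [formalX0_eq_ham, Derivation.map_smul, smul_smul, inv_mul_cancel₀ (Nat.cast_ne_zero.2 hδ),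
    one_smul]

theorem ham_eq_smul_formalX0 (hδ : δ ≠ 0) (w : FormalO2) :
    ham h 0 1 w = (δ : ℂ) • formalX0 δ h w := by
  rw [← formalX0_smul_eq_ham hδ, Derivation.map_smul]

theorem subst_tail (h0 : MvPolynomial.constantCoeff h = 0) (l : PowerSeries ℂ) :
    l.subst (h : FormalO2) = algebraMap ℂ FormalO2 (PowerSeries.constantCoeff l) +
      (h : FormalO2) * PowerSeries.subst (h : FormalO2) (shift () 1 l : PowerSeries ℂ) := by
  have hs := hasSubst_coe h0
  conv_lhs => rw [eq_C_add_X_mul_tail l]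
  rw [PowerSeries.subst_add hs, PowerSeries.subst_mul hs, PowerSeries.subst_X hs]
  congr 1
  have := (PowerSeries.substAlgHom (R := ℂ) hs).commutes (PowerSeries.constantCoeff l)
  rwa [PowerSeries.coe_substAlgHom] at this

theorem exists_mul_eq_one {σ : Type*} {f : MvPowerSeries σ ℂ}
    (h0 : MvPowerSeries.constantCoeff f ≠ 0) :
    ∃ g, f * g = 1 ∧ (IsConvergent f → IsConvergent g) :=
  ⟨f⁻¹, MvPowerSeries.mul_inv_cancel f h0, fun hf => hf.inv h0⟩

/-- Inverting `X * l + 1` in one variable and then substituting `h` keeps the inverse inside the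
ring of series in `h`; this places `h` in its Jacobson radical. -/
theorem exists_one_add_mul_subst_mul_eq_one (h0 : MvPolynomial.constantCoeff h = 0)
    (l : PowerSeries ℂ) : ∃ k : PowerSeries ℂ, (IsConvergent l → IsConvergent k) ∧
      ((h : FormalO2) * l.subst (h : FormalO2) + 1) * k.subst (h : FormalO2) = 1 := by
  have hs := hasSubst_coe h0
  have hc : MvPowerSeries.constantCoeff (PowerSeries.X * l + 1 : PowerSeries ℂ) ≠ 0 := by
    change PowerSeries.constantCoeff _ ≠ 0
    simp
  obtain ⟨k, hk, hkc⟩ := exists_mul_eq_one hc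
  refine ⟨k, fun hl => hkc (((IsConvergent.X ()).mul hl).add .one), ?_⟩
  have h1 : PowerSeries.subst (h : FormalO2) (PowerSeries.X * l + 1 : PowerSeries ℂ) =
      (h : FormalO2) * l.subst (h : FormalO2) + 1 := by
    rw [PowerSeries.subst_add hs, PowerSeries.subst_mul hs, PowerSeries.subst_X hs,
      ← PowerSeries.coe_substAlgHom hs, map_one]
  rw [← h1, ← PowerSeries.subst_mul hs]
  refine (congrArg (PowerSeries.subst (h : FormalO2)) hk).trans ?_
  rw [← PowerSeries.coe_substAlgHom hs]
  exact map_one _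

theorem formal_cokernel (hδ : δ ≠ 0) (hne : h ≠ 0)
    (hh : MvPolynomial.IsWeightedHomogeneous p h δ) (h0 : MvPolynomial.constantCoeff h = 0)
    (D : SingularityData p h N e S W) {n : ℕ} (a : Fin n → FormalO2)
    (ha : FormsBasis ℂ fun i => Ideal.Quotient.mk (formalJ0 h) (a i)) :
    FormsBasis (formalSeriesIn h h0) fun i => (Submodule.Quotient.mk (a i) : FormalCoker δ h h0) := by
  have hX : (h : FormalO2) ∈ formalSeriesIn h h0 :=
    mem_formalSeriesIn.2 ⟨PowerSeries.X, PowerSeries.subst_X (hasSubst_coe h0)⟩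
  have hmem : ∀ l : PowerSeries ℂ, l.subst (h : FormalO2) ∈ formalSeriesIn h h0 :=
    fun l => mem_formalSeriesIn.2 ⟨l, rfl⟩
  refine formsBasis_coker (formalX0 δ h) _ (formalX0_formalSeriesIn δ h h0) ⟨h, hX⟩ (formalJ0 h)
    ?_ ?_ ?_ ?_ ?_ ?_ ?_ ?_ a ha
  · rintro ⟨s, hs⟩
    obtain ⟨l, rfl⟩ := mem_formalSeriesIn.1 hs
    exact ⟨PowerSeries.constantCoeff l, ⟨_, hmem (shift () 1 l : PowerSeries ℂ)⟩,
      Subtype.ext (subst_tail h0 l)⟩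
  · rintro ⟨s, hs⟩
    obtain ⟨l, rfl⟩ := mem_formalSeriesIn.1 hs
    obtain ⟨k, -, hk⟩ := exists_one_add_mul_subst_mul_eq_one h0 l
    exact IsUnit.of_mul_eq_one ⟨_, hmem k⟩ (Subtype.ext hk)
  · rintro ⟨s, hs⟩ hdvd
    refine Subtype.ext (eq_of_forall_pow_dvd_sub (constantCoeff_coe h0) fun k => ?_)
    obtain ⟨t, ht⟩ := hdvd k
    exact ⟨t, by simpa using congrArg Subtype.val ht⟩
  · intro b w hb
    -- The factor `δ` passes from `X_0` to `H = δ X_0`.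
    obtain ⟨c, t, -, ht, -⟩ := exists_eq_const_add_mul hh hδ hne D.primary D.eulerKernel
      (w := w) (g := (δ : ℂ) • b) (by rw [ham_eq_smul_formalX0 hδ, ← hb, mul_smul_comm])
    refine ⟨t, ?_⟩
    rw [formalX0_eq_ham, ht, smul_smul, inv_mul_cancel₀ (Nat.cast_ne_zero.2 hδ), one_smul]
  · intro w
    rw [formalX0_eq_ham, mem_formalJ0]
    refine ⟨-((δ : ℂ)⁻¹ • MvPowerSeries.pderiv ℂ 1 w), (δ : ℂ)⁻¹ • MvPowerSeries.pderiv ℂ 0 w, ?_⟩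
    rw [ham_apply, MvPowerSeries.smul_eq_C_mul, MvPowerSeries.smul_eq_C_mul,
      MvPowerSeries.smul_eq_C_mul]
    ring
  · rw [mem_formalJ0]
    have hE := euler_jac hh (by decide : (0 : Fin 2) ≠ 1)
    have hδ' : MvPowerSeries.C (δ : ℂ)⁻¹ * (δ : FormalO2) = 1 := by
      rw [← map_natCast MvPowerSeries.C, ← map_mul, inv_mul_cancel₀ (Nat.cast_ne_zero.2 hδ), map_one]
    refine ⟨MvPowerSeries.C (δ : ℂ)⁻¹ * ((p 0 : FormalO2) * MvPowerSeries.X 0),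
      MvPowerSeries.C (δ : ℂ)⁻¹ * ((p 1 : FormalO2) * MvPowerSeries.X 1), ?_⟩
    linear_combination MvPowerSeries.C (δ : ℂ)⁻¹ * hE + (h : FormalO2) * hδ'
  · intro b hb
    obtain ⟨A, B, rfl⟩ := mem_formalJ0.1 hb
    obtain ⟨b', w, hbw, -⟩ := D.jacobianReduces A B
    exact ⟨b', (δ : ℂ) • w, by rw [hbw, formalX0_smul_eq_ham hδ]⟩
  · refine ⟨ι, inferInstance, fun i => MvPowerSeries.monomial (e i) 1, fun b => ?_⟩
    obtain ⟨l, w, hb, -⟩ := D.reduction.exists_eq h0 b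
    exact ⟨fun i => ⟨_, hmem (l i)⟩, (δ : ℂ) • w, by rw [formalX0_smul_eq_ham hδ]; exact hb⟩

theorem germ_cokernel (hδ : δ ≠ 0) (hne : h ≠ 0)
    (hh : MvPolynomial.IsWeightedHomogeneous p h δ) (h0 : MvPolynomial.constantCoeff h = 0)
    (D : SingularityData p h N e S W) {n : ℕ} (a : Fin n → O2)
    (ha : FormsBasis ℂ fun i => Ideal.Quotient.mk (J0 h) (a i)) :
    FormsBasis (seriesIn h h0) fun i => (Submodule.Quotient.mk (a i) : Coker δ h h0) := by
  have hu := constantCoeff_coe h0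
  have hX : polyGerm h ∈ seriesIn h h0 := mem_seriesIn.2 ⟨PowerSeries.X, IsConvergent.X (),
    PowerSeries.subst_X (hasSubst_coe h0)⟩
  have hconv : ∀ l : PowerSeries ℂ, IsConvergent l → IsConvergent (l.subst (h : FormalO2)) :=
    fun l hl => IsConvergent.subst hu (.coe h) hl
  have hmem : ∀ (l : PowerSeries ℂ) (hl : IsConvergent l), germ _ (hconv l hl) ∈ seriesIn h h0 :=
    fun l hl => mem_seriesIn.2 ⟨l, hl, rfl⟩
  refine formsBasis_coker (X0 δ h) _ (X0_seriesIn δ h h0) ⟨polyGerm h, hX⟩ (J0 h)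
    ?_ ?_ ?_ ?_ ?_ ?_ ?_ ?_ a ha
  · rintro ⟨s, hs⟩
    obtain ⟨l, hl, hls⟩ := mem_seriesIn.1 hs
    refine ⟨PowerSeries.constantCoeff l, ⟨_, hmem _ hl.tail⟩, Subtype.ext (taylor_injective ?_)⟩
    change taylor s = taylor (algebraMap ℂ O2 _ + polyGerm h * germ _ _)
    rw [← hls, subst_tail h0 l, map_add, map_mul, AlgHom.commutes]
    rfl
  · rintro ⟨s, hs⟩
    obtain ⟨l, hl, hls⟩ := mem_seriesIn.1 hs
    obtain ⟨k, hk, hlk⟩ := exists_one_add_mul_subst_mul_eq_one h0 l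
    refine IsUnit.of_mul_eq_one ⟨_, hmem k (hk hl)⟩ (Subtype.ext (taylor_injective ?_))
    rw [hls] at hlk
    change taylor ((polyGerm h * s + 1) * germ _ _) = taylor 1
    rw [map_mul, map_add, map_mul, map_one]
    exact hlk
  · rintro ⟨s, hs⟩ hdvd
    refine Subtype.ext (taylor_injective (eq_of_forall_pow_dvd_sub hu fun k => ?_))
    obtain ⟨t, ht⟩ := hdvd k
    have h1 : s = polyGerm h ^ k * t := congrArg Subtype.val ht
    refine ⟨taylor t, ?_⟩
    change taylor s - taylor 0 = _
    rw [h1, map_mul, map_pow, map_zero, sub_zero]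
    rfl
  · intro b w hb
    have hb' : (h : FormalO2) * taylor b = formalX0 δ h (taylor w) := by
      rw [← taylor_X0, ← hb, map_mul]; rfl
    obtain ⟨c, t, -, ht, hc⟩ := exists_eq_const_add_mul hh hδ hne D.primary D.eulerKernel
      (w := taylor w) (g := (δ : ℂ) • taylor b)
      (by rw [ham_eq_smul_formalX0 hδ, ← hb', mul_smul_comm])
    refine ⟨germ t (hc (isConvergent_taylor w) ((isConvergent_taylor b).smul _)),
      taylor_injective ?_⟩
    rw [taylor_X0, taylor_germ, formalX0_eq_ham, ht, smul_smul,
      inv_mul_cancel₀ (Nat.cast_ne_zero.2 hδ), one_smul]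
  · intro w
    rw [mem_J0, taylor_X0, formalX0_eq_ham]
    have hw := isConvergent_taylor w
    refine ⟨-((δ : ℂ)⁻¹ • MvPowerSeries.pderiv ℂ 1 (taylor w)),
      (δ : ℂ)⁻¹ • MvPowerSeries.pderiv ℂ 0 (taylor w),
      (convergentSeries (Fin 2)).neg_mem ((hw.pderiv 1).smul _), (hw.pderiv 0).smul _, ?_⟩
    rw [ham_apply, MvPowerSeries.smul_eq_C_mul, MvPowerSeries.smul_eq_C_mul,
      MvPowerSeries.smul_eq_C_mul]
    ring
  · rw [mem_J0]
    have hE := euler_jac hh (by decide : (0 : Fin 2) ≠ 1)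
    have hδ' : MvPowerSeries.C (δ : ℂ)⁻¹ * (δ : FormalO2) = 1 := by
      rw [← map_natCast MvPowerSeries.C, ← map_mul, inv_mul_cancel₀ (Nat.cast_ne_zero.2 hδ), map_one]
    refine ⟨MvPowerSeries.C (δ : ℂ)⁻¹ * ((p 0 : FormalO2) * MvPowerSeries.X 0),
      MvPowerSeries.C (δ : ℂ)⁻¹ * ((p 1 : FormalO2) * MvPowerSeries.X 1),
      (IsConvergent.const _).mul ((isConvergent_natCast _).mul (.X 0)),
      (IsConvergent.const _).mul ((isConvergent_natCast _).mul (.X 1)), ?_⟩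
    change _ = (h : FormalO2)
    linear_combination MvPowerSeries.C (δ : ℂ)⁻¹ * hE + (h : FormalO2) * hδ'
  · intro b hb
    obtain ⟨A, B, hA, hB, hAB⟩ := mem_J0.1 hb
    obtain ⟨b', w, hbw, hc⟩ := D.jacobianReduces A B
    refine ⟨germ b' (hc hA hB).1, germ _ ((hc hA hB).2.smul (δ : ℂ)), taylor_injective ?_⟩
    rw [map_add, map_mul, taylor_X0, taylor_germ, taylor_germ, formalX0_smul_eq_ham hδ, ← hAB]
    exact hbw
  · refine ⟨ι, inferInstance, fun i => polyGerm (MvPolynomial.monomial (e i) 1), fun b => ?_⟩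
    obtain ⟨l, w, hb, hc⟩ := D.reduction.exists_eq h0 (taylor b)
    obtain ⟨hl, hw⟩ := hc (isConvergent_taylor b)
    refine ⟨fun i => ⟨_, hmem (l i) (hl i)⟩, germ _ (hw.smul (δ : ℂ)), taylor_injective ?_⟩
    rw [map_add, map_sum, taylor_X0, taylor_germ, formalX0_smul_eq_ham hδ]
    simp only [map_mul, taylor_polyGerm_monomial, taylor_germ]
    exact hb

end Main

end HamiltonianCokernel

end

/-! ### The main theorem -/

open HamiltonianCokernel in
theorem mainTheorem3 (p : Fin 2 → ℕ) (hp : Nat.Coprime (p 0) (p 1)) (δ : ℕ)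
    (h : MvPolynomial (Fin 2) ℂ) (hh : MvPolynomial.IsWeightedHomogeneous p h δ)
    (hs : IsIsolatedSingularity h) :
    -- the Milnor number is finite and positive
    Module.Finite ℂ (O2 ⧸ J0 h) ∧ 0 < milnor h ∧
    -- germs of holomorphic functions
    (LinearMap.ker (X0 δ h : O2 →ₗ[ℂ] O2) =
        Subalgebra.toSubmodule (seriesIn h (constantCoeff_eq_zero hp hh hs)) ∧
      (∃ a : Fin (milnor h) → (Fin 2 →₀ ℕ), (∀ i, i.val = 0 → a i = 0) ∧
        FormsBasis ℂ fun i => Ideal.Quotient.mk (J0 h) (polyGerm (MvPolynomial.monomial (a i) 1))) ∧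
      ∀ a : Fin (milnor h) → O2,
        FormsBasis ℂ (fun i => Ideal.Quotient.mk (J0 h) (a i)) →
        FormsBasis (seriesIn h (constantCoeff_eq_zero hp hh hs))
          (fun i => (Submodule.Quotient.mk (a i) : Coker δ h (constantCoeff_eq_zero hp hh hs)))) ∧
    -- formal power series
    (LinearMap.ker (formalX0 δ h : FormalO2 →ₗ[ℂ] FormalO2) =
        Subalgebra.toSubmodule (formalSeriesIn h (constantCoeff_eq_zero hp hh hs)) ∧
      (∃ a : Fin (milnor h) → (Fin 2 →₀ ℕ), (∀ i, i.val = 0 → a i = 0) ∧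
        FormsBasis ℂ fun i => Ideal.Quotient.mk (formalJ0 h) (MvPowerSeries.monomial (a i) 1)) ∧
      ∀ a : Fin (milnor h) → FormalO2,
        FormsBasis ℂ (fun i => Ideal.Quotient.mk (formalJ0 h) (a i)) →
        FormsBasis (formalSeriesIn h (constantCoeff_eq_zero hp hh hs))
          (fun i =>
            (Submodule.Quotient.mk (a i) : FormalCoker δ h (constantCoeff_eq_zero hp hh hs)))) := by
  have h0 := constantCoeff_eq_zero hp hh hs
  have hδ := degree_ne_zero hp hh hs
  have hne := ne_zero_of_isIsolatedSingularity hs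
  obtain ⟨N, ι, _, e, S, W, D⟩ := exists_singularityData hp hh hs
  have hX0 : ∀ w, formalX0 δ h w = 0 → ham h 0 1 w = 0 := fun w hw => by
    rw [ham_eq_smul_formalX0 hδ, hw, smul_zero]
  refine ⟨finite_quotient_J0 D.primary, milnor_pos hs D.primary, ⟨?_, ?_, ?_⟩, ?_, ?_, ?_⟩
  · ext f
    rw [LinearMap.mem_ker, Subalgebra.mem_toSubmodule]
    refine ⟨fun hf => ?_, fun hf => X0_seriesIn δ h h0 f hf⟩
    have hf' : formalX0 δ h (taylor f) = 0 := by
      rw [← taylor_X0]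
      exact (congrArg taylor hf).trans (map_zero taylor)
    obtain ⟨l, hl⟩ := exists_subst_of_ham_eq_zero hh hδ h0 hne D.primary D.eulerKernel (hX0 _ hf')
    -- The formal kernel supplies `l`; its convergence is recovered from that of `l(h)`.
    exact mem_seriesIn.2 ⟨l, isConvergent_of_subst hδ hh hne h0
      (by rw [hl]; exact isConvergent_taylor f), hl⟩
  · exact exists_monomial_basis hs D.primary
  · exact fun a ha => germ_cokernel hδ hne hh h0 D a ha
  · ext f
    rw [LinearMap.mem_ker, Subalgebra.mem_toSubmodule]
    refine ⟨fun hf => ?_, fun hf => formalX0_formalSeriesIn δ h h0 f hf⟩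
    exact mem_formalSeriesIn.2
      (exists_subst_of_ham_eq_zero hh hδ h0 hne D.primary D.eulerKernel (hX0 f hf))
  -- The convergent monomial basis is transported along `milnorEquiv`, which also shows that the
  -- formal dimension is the same `μ`.
  · obtain ⟨a, ha0, ha⟩ := exists_monomial_basis hs D.primary
    refine ⟨a, ha0, ?_⟩
    have := ha.map (milnorEquiv D.primary)
    simpa only [milnorEquiv_mk, taylor_polyGerm_monomial] using this
  · exact fun a ha => formal_cokernel hδ hne hh h0 D a ha
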